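/- A cube complex is a metric polyhedral complex all of whose cells are unit Euclidean cubes $[0,1]^n$ glued along faces by isometries, with its intrinsic path metric (no restriction on the number or the dimensions of the cubes). For a point $p$ of a CAT(0) space $Y$, the tangent cone $TC_pY$ is the Euclidean cone over the space of directions at $p$ (classes of geodesics issuing from $p$, with the Alexandrov angle as metric), and $O$ is its origin. For a metric space $T$, the distortion $D(T)$ is the infimum of all $D>0$ for which there are a Hilbert space $\mathcal H$ and a map $f:T\to\mathcal H$ with $$\frac1D\,d_T(v,w)\le\|f(v)-f(w)\|\le d_T(v,w)\qquad(v,w\in T);$$ for a metric cone $T$ with origin $O$, the radial distortion $D_{\mathrm{rad}}(T)$ is defined in the same way, with the additional condition $\|f(v)\|=d_T(O,v)$ for all $v\in T$. (The infimum of the empty set is $\infty$.) Proposition. Let $Y$ be a CAT(0) cube complex, not necessarily complete, locally compact or finite dimensional, and let $p\in Y$. Then $$D(TC_pY)\le\sqrt2,\qquad D_{\mathrm{rad}}(TC_pY)\le\sqrt2,$$ and the same two bounds hold for the metric completion of $TC_pY$. Moreover, there are a Hilbert space $\mathcal H$ and a map $f:TC_pY\to\mathcal H$ such that 1. $\|f(v)\|=d(O,v)$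 and $\frac1{\sqrt2}d(v,w)\le\|f(v)-f(w)\|\le d(v,w)$ for all $v,w\in TC_pY$; 2. if $p$ is a vertex, then $f$ sends the unit vectors in the directions of distinct edges at $p$ to orthonormal vectors; 3. $f$ is linear and isometric on each cube: for every cube $[0,1]^n\to Y$ and every point $x$ of it that is mapped to $p$, there is a linear isometric embedding $L:\mathbb R^n\to\mathcal H$ such that, whenever the geodesic $c$ issuing from $p$ is near $p$ the image of the segment $t\mapsto x+tv$ in this cube, the tangent vector of length $r\ge 0$ in the direction of $c$ is sent to $rL(v)$. -/

import Mathlib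

open Filter Topology
open scoped NNReal ENNReal

universe u v

/-! ### Geodesics and CAT(0) spaces -/

/-- `c` restricted to `[0, l]` is a unit speed geodesic. -/
def IsGeodesicOn {X : Type u} [MetricSpace X] (c : ℝ → X) (l : ℝ) : Prop :=
  ∀ s ∈ Set.Icc 0 l, ∀ t ∈ Set.Icc 0 l, dist (c s) (c t) = |s - t|

/-- `c` restricted to `[0, dist x y]` is a (unit speed) geodesic from `x` to `y`. -/
def IsGeodesicFromTo {X : Type u} [MetricSpace X] (c : ℝ → X) (x y : X) : Prop :=
  c 0 = x ∧ c (dist x y) = y ∧ IsGeodesicOn c (dist x y)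

/-- CAT(0) spaces: geodesic metric spaces all of whose geodesic triangles are at least as thin as
their comparison triangles in the Euclidean plane. Any two sides of a triangle share a vertex,
which is called `p` here; `x'` and `y'` are the comparison points of `c s` and `c' t`. -/
structure IsCAT0 (X : Type u) [MetricSpace X] : Prop where
  exists_geodesic : ∀ x y : X, ∃ c : ℝ → X, IsGeodesicFromTo c x y
  comparison : ∀ (p q r : X) (c c' : ℝ → X),
    IsGeodesicFromTo c p q → IsGeodesicFromTo c' p r →
    ∀ p' q' r' : EuclideanSpace ℝ (Fin 2),
      dist p' q' = dist p q → dist p' r' = dist p r → dist q' r' = dist q r →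
    ∀ s ∈ Set.Icc 0 (dist p q), ∀ t ∈ Set.Icc 0 (dist p r),
    ∀ x' ∈ segment ℝ p' q', ∀ y' ∈ segment ℝ p' r', dist p' x' = s → dist p' y' = t →
      dist (c s) (c' t) ≤ dist x' y'

/-! ### Cube complexes -/

/-- The Euclidean cube `[0,1]^n`. -/
def unitCube (n : ℕ) : Set (EuclideanSpace ℝ (Fin n)) :=
  {x | ∀ i, 0 ≤ x i ∧ x i ≤ 1}

/-- The support of a point `x` of the cube: the smallest closed face containing `x`. -/
def cubeSupport {n : ℕ} (x : EuclideanSpace ℝ (Fin n)) : Set (EuclideanSpace ℝ (Fin n)) :=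
  {y | y ∈ unitCube n ∧ ∀ i, (x i = 0 → y i = 0) ∧ (x i = 1 → y i = 1)}

/-- The points `x` and `y` of the cube lie in the relative interior of the same face. -/
def SameOpenFace {n : ℕ} (x y : EuclideanSpace ℝ (Fin n)) : Prop :=
  ∀ i, (x i = 0 ↔ y i = 0) ∧ (x i = 1 ↔ y i = 1)

/-- Given cells `char a : [0,1]^(dim a) → X`, the proposition `IsCubeString dim char p q l` says
that there is a finite chain of points from `p` to `q` such that consecutive points lie in a
common cell, and the sum of the Euclidean distances in these cells is `l`. -/
inductive IsCubeString {X : Type u} {Cell : Type v} (dim : Cell → ℕ)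
    (char : (a : Cell) → EuclideanSpace ℝ (Fin (dim a)) → X) : X → X → ℝ → Prop
  | nil (p : X) : IsCubeString dim char p p 0
  | cons (a : Cell) (x y : EuclideanSpace ℝ (Fin (dim a))) (q : X) (l : ℝ)
      (hx : x ∈ unitCube (dim a)) (hy : y ∈ unitCube (dim a))
      (h : IsCubeString dim char (char a y) q l) :
      IsCubeString dim char (char a x) q (dist x y + l)

/-- A structure of cube complex on the metric space `X`, i.e. of a metric polyhedral complex all of
whose cells are unit cubes. Here `X` is the quotient of the disjoint union of the cubes
`[0,1]^(dim a)`, the restriction of the quotient map to the cube `a` being `char a` (its values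
outside of the cube are irrelevant); faces are glued by isometries; and the metric of `X` is the
intrinsic one. There is no restriction on the dimensions or on the number of cubes, and cubes
need not be embedded. -/
structure CubeComplex (X : Type u) [MetricSpace X] where
  /-- the index set of the cubes -/
  Cell : Type v
  /-- the dimensions of the cubes -/
  dim : Cell → ℕ
  /-- the characteristic maps of the cubes -/
  char : (a : Cell) → EuclideanSpace ℝ (Fin (dim a)) → X
  cover : ∀ p : X, ∃ a, ∃ x ∈ unitCube (dim a), char a x = p
  inj : ∀ a, ∀ x ∈ unitCube (dim a), ∀ y ∈ unitCube (dim a),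
    SameOpenFace x y → char a x = char a y → x = y
  glue : ∀ a b, ∀ x ∈ unitCube (dim a), ∀ y ∈ unitCube (dim b), char a x = char b y →
    ∃ h : cubeSupport x ≃ᵢ cubeSupport y, ∀ z : cubeSupport x, char a z = char b (h z)
  isGLB_dist : ∀ p q : X, IsGLB {l : ℝ | IsCubeString dim char p q l} (dist p q)

/-! ### Alexandrov angles -/

/-- A nonconstant unit speed geodesic issuing from `p`. -/
structure GeodesicFrom {X : Type u} [MetricSpace X] (p : X) where
  /-- the underlying map, relevant on `[0, length]` only -/
  toFun : ℝ → X
  /-- the length of the geodesic -/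
  length : ℝ
  length_pos : 0 < length
  map_zero : toFun 0 = p
  isGeodesicOn : IsGeodesicOn toFun length

/-- The angle opposite to the side of length `d` in a Euclidean triangle whose other two sides have
lengths `a, b > 0`. -/
noncomputable def comparisonAngle (a b d : ℝ) : ℝ :=
  Real.arccos ((a ^ 2 + b ^ 2 - d ^ 2) / (2 * a * b))

/-- The Alexandrov angle between two geodesics issuing from `p`: the upper limit, for
`t, t' → 0` independently, of the comparison angle at `p` of the triangle `p, c t, c' t'`. -/
noncomputable def alexandrovAngle {X : Type u} [MetricSpace X] {p : X}
    (c c' : GeodesicFrom p) : ℝ :=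
  limsup (fun z : ℝ × ℝ => comparisonAngle z.1 z.2 (dist (c.toFun z.1) (c'.toFun z.2)))
    (𝓝[>] (0 : ℝ) ×ˢ 𝓝[>] (0 : ℝ))

section Helpers

theorem comparisonAngle_nonneg (a b d : ℝ) : 0 ≤ comparisonAngle a b d := Real.arccos_nonneg _

theorem comparisonAngle_le_pi (a b d : ℝ) : comparisonAngle a b d ≤ Real.pi :=
  Real.arccos_le_pi _

variable {X : Type u} [MetricSpace X] {p : X}

theorem comparisonAngle_isBoundedUnder_le (c c' : GeodesicFrom p) :
    IsBoundedUnder (· ≤ ·) (𝓝[>] (0 : ℝ) ×ˢ 𝓝[>] (0 : ℝ))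
      (fun z : ℝ × ℝ => comparisonAngle z.1 z.2 (dist (c.toFun z.1) (c'.toFun z.2))) :=
  isBoundedUnder_of ⟨Real.pi, fun _ => comparisonAngle_le_pi _ _ _⟩

theorem comparisonAngle_isBoundedUnder_ge (c c' : GeodesicFrom p) :
    IsBoundedUnder (· ≥ ·) (𝓝[>] (0 : ℝ) ×ˢ 𝓝[>] (0 : ℝ))
      (fun z : ℝ × ℝ => comparisonAngle z.1 z.2 (dist (c.toFun z.1) (c'.toFun z.2))) :=
  isBoundedUnder_of ⟨0, fun _ => comparisonAngle_nonneg _ _ _⟩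

theorem alexandrovAngle_nonneg (c c' : GeodesicFrom p) : 0 ≤ alexandrovAngle c c' :=
  le_limsup_of_frequently_le
    (Frequently.of_forall fun _ => comparisonAngle_nonneg _ _ _)
    (comparisonAngle_isBoundedUnder_le c c')

theorem alexandrovAngle_le_pi (c c' : GeodesicFrom p) : alexandrovAngle c c' ≤ Real.pi :=
  limsup_le_of_le (comparisonAngle_isBoundedUnder_ge c c').isCoboundedUnder_le
    (Eventually.of_forall fun _ => comparisonAngle_le_pi _ _ _)

theorem GeodesicFrom.eventually_mem (c : GeodesicFrom p) :
    ∀ᶠ t in 𝓝[>] (0 : ℝ), 0 < t ∧ t ≤ c.length := by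
  filter_upwards [Ioc_mem_nhdsGT c.length_pos] with t ht using ht

theorem alexandrovAngle_self (c : GeodesicFrom p) : alexandrovAngle c c = 0 := by
  have h : (fun z : ℝ × ℝ => comparisonAngle z.1 z.2 (dist (c.toFun z.1) (c.toFun z.2)))
      =ᶠ[𝓝[>] (0 : ℝ) ×ˢ 𝓝[>] (0 : ℝ)] fun _ => (0 : ℝ) := by
    filter_upwards [c.eventually_mem.prod_mk c.eventually_mem] with z hz
    obtain ⟨⟨h1, h1'⟩, h2, h2'⟩ := hz
    have hd := c.isGeodesicOn z.1 ⟨h1.le, h1'⟩ z.2 ⟨h2.le, h2'⟩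
    have : (z.1 ^ 2 + z.2 ^ 2 - |z.1 - z.2| ^ 2) / (2 * z.1 * z.2) = 1 := by
      rw [sq_abs]; field_simp; ring
    rw [comparisonAngle, hd, this, Real.arccos_one]
  rw [alexandrovAngle, limsup_congr h, limsup_const]

theorem alexandrovAngle_comm (c c' : GeodesicFrom p) :
    alexandrovAngle c c' = alexandrovAngle c' c := by
  unfold alexandrovAngle
  conv_lhs => rw [Filter.prod_comm]
  rw [limsup, Filter.map_map]
  rw [limsup]
  congr 2
  funext z
  simp only [Function.comp, Prod.fst_swap, Prod.snd_swap, comparisonAngle]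
  rw [dist_comm]
  ring_nf

/-- Third side of a Euclidean triangle with two sides `r, s` enclosing the angle `a`. -/
noncomputable def thirdSide (r s a : ℝ) : ℝ :=
  Real.sqrt (r ^ 2 + s ^ 2 - 2 * r * s * Real.cos a)

theorem thirdSide_eq_norm_left (r s a : ℝ) :
    thirdSide r s a = ‖(⟨r * Real.cos a, -(r * Real.sin a)⟩ : ℂ) - (s : ℂ)‖ := by
  rw [Complex.norm_eq_sqrt_sq_add_sq, thirdSide]
  congr 1
  simp only [Complex.sub_re, Complex.sub_im, Complex.ofReal_re, Complex.ofReal_im]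
  linear_combination (-r ^ 2) * Real.sin_sq_add_cos_sq a

theorem thirdSide_eq_norm_right (s t b : ℝ) :
    thirdSide s t b = ‖(s : ℂ) - (⟨t * Real.cos b, t * Real.sin b⟩ : ℂ)‖ := by
  rw [Complex.norm_eq_sqrt_sq_add_sq, thirdSide]
  congr 1
  simp only [Complex.sub_re, Complex.sub_im, Complex.ofReal_re, Complex.ofReal_im]
  linear_combination (-t ^ 2) * Real.sin_sq_add_cos_sq b

theorem thirdSide_eq_norm (r t a b : ℝ) :
    thirdSide r t (a + b) = ‖(⟨r * Real.cos a, -(r * Real.sin a)⟩ : ℂ)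
      - (⟨t * Real.cos b, t * Real.sin b⟩ : ℂ)‖ := by
  rw [Complex.norm_eq_sqrt_sq_add_sq, thirdSide]
  congr 1
  simp only [Complex.sub_re, Complex.sub_im, Real.cos_add]
  linear_combination (-r ^ 2) * Real.sin_sq_add_cos_sq a + (-t ^ 2) * Real.sin_sq_add_cos_sq b

theorem thirdSide_mono {r s a b : ℝ} (hr : 0 ≤ r) (hs : 0 ≤ s) (ha : 0 ≤ a) (hab : a ≤ b)
    (hb : b ≤ Real.pi) : thirdSide r s a ≤ thirdSide r s b := by
  apply Real.sqrt_le_sqrt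
  have := Real.cos_le_cos_of_nonneg_of_le_pi ha hb hab
  have := mul_le_mul_of_nonneg_left this (by positivity : 0 ≤ 2 * r * s)
  linarith

theorem thirdSide_triangle {r s t a b c : ℝ} (hr : 0 ≤ r) (hs : 0 ≤ s) (ht : 0 ≤ t)
    (ha' : a ≤ Real.pi) (hb : 0 ≤ b) (hb' : b ≤ Real.pi) (hc : 0 ≤ c)
    (hc' : c ≤ Real.pi) (h : c ≤ a + b) :
    thirdSide r t c ≤ thirdSide r s a + thirdSide s t b := by
  set b' := min b (Real.pi - a) with hb'def
  have h1 : b' ≤ b := min_le_left _ _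
  have h2 : b' ≤ Real.pi - a := min_le_right _ _
  have h0 : 0 ≤ b' := le_min hb (by linarith)
  have h3 : c ≤ a + b' := by
    rcases min_choice b (Real.pi - a) with h' | h' <;> rw [hb'def, h'] <;> linarith
  calc thirdSide r t c ≤ thirdSide r t (a + b') := thirdSide_mono hr ht hc h3 (by linarith)
    _ ≤ thirdSide r s a + thirdSide s t b' := by
      rw [thirdSide_eq_norm, thirdSide_eq_norm_left, thirdSide_eq_norm_right]
      exact norm_sub_le_norm_sub_add_norm_sub _ _ _
    _ ≤ thirdSide r s a + thirdSide s t b := by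
      gcongr; exact thirdSide_mono hs ht h0 h1 hb'

theorem cos_comparisonAngle {a b d : ℝ} (ha : 0 < a) (hb : 0 < b) (h1 : |a - b| ≤ d)
    (h2 : d ≤ a + b) : thirdSide a b (comparisonAngle a b d) = d := by
  have hd : 0 ≤ d := (abs_nonneg _).trans h1
  have hsq : (a - b) ^ 2 ≤ d ^ 2 := by
    rw [← sq_abs (a - b)]; gcongr
  have hsq' : d ^ 2 ≤ (a + b) ^ 2 := by gcongr
  have hab : 0 < 2 * a * b := by positivity
  rw [thirdSide, comparisonAngle, Real.cos_arccos]
  · rw [mul_div_cancel₀ _ hab.ne']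
    rw [show a ^ 2 + b ^ 2 - (a ^ 2 + b ^ 2 - d ^ 2) = d ^ 2 by ring, Real.sqrt_sq hd]
  · rw [le_div_iff₀ hab]; nlinarith
  · rw [div_le_iff₀ hab]; nlinarith

theorem GeodesicFrom.dist_eq (c : GeodesicFrom p) {t : ℝ} (ht : 0 < t) (ht' : t ≤ c.length) :
    dist (c.toFun t) p = t := by
  have := c.isGeodesicOn t ⟨ht.le, ht'⟩ 0 ⟨le_rfl, c.length_pos.le⟩
  rwa [c.map_zero, sub_zero, abs_of_pos ht] at this

theorem GeodesicFrom.dist_bounds (c c' : GeodesicFrom p) {s t : ℝ} (hs : 0 < s)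
    (hs' : s ≤ c.length) (ht : 0 < t) (ht' : t ≤ c'.length) :
    |s - t| ≤ dist (c.toFun s) (c'.toFun t) ∧ dist (c.toFun s) (c'.toFun t) ≤ s + t := by
  have h1 := c.dist_eq hs hs'
  have h2 := c'.dist_eq ht ht'
  constructor
  · have := abs_dist_sub_le (c.toFun s) (c'.toFun t) p
    rwa [h1, h2] at this
  · have := dist_triangle_right (c.toFun s) (c'.toFun t) p
    rwa [h1, h2] at this

theorem alexandrovAngle_triangle (c c' c'' : GeodesicFrom p) :
    alexandrovAngle c c'' ≤ alexandrovAngle c c' + alexandrovAngle c' c'' := by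
  by_contra! hlt
  set α := alexandrovAngle c c' with hα
  set β := alexandrovAngle c' c'' with hβ
  set γ := alexandrovAngle c c'' with hγ
  have hα0 : 0 ≤ α := alexandrovAngle_nonneg _ _
  have hβ0 : 0 ≤ β := alexandrovAngle_nonneg _ _
  have hγπ : γ ≤ Real.pi := alexandrovAngle_le_pi _ _
  obtain ⟨δ, hδ0, hδ⟩ : ∃ δ : ℝ, 0 < δ ∧ α + β + 3 * δ < γ :=
    ⟨(γ - (α + β)) / 4, by linarith, by linarith⟩
  set A := α + δ with hA
  set B := β + δ with hB
  have hA0 : 0 < A := by linarith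
  have hB0 : 0 < B := by linarith
  have hABπ : A + B < Real.pi := by linarith
  have hsA : 0 < Real.sin A := Real.sin_pos_of_pos_of_lt_pi hA0 (by linarith)
  have hsB : 0 < Real.sin B := Real.sin_pos_of_pos_of_lt_pi hB0 (by linarith)
  have hsAB : 0 < Real.sin (A + B) := Real.sin_pos_of_pos_of_lt_pi (by linarith) hABπ
  have e1 := eventually_lt_of_limsup_lt (show limsup _ _ < A by
    rw [← alexandrovAngle, ← hα]; linarith) (comparisonAngle_isBoundedUnder_le c c')
  have e2 := eventually_lt_of_limsup_lt (show limsup _ _ < B by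
    rw [← alexandrovAngle, ← hβ]; linarith) (comparisonAngle_isBoundedUnder_le c' c'')
  have e3 := frequently_lt_of_lt_limsup
    (comparisonAngle_isBoundedUnder_ge c c'').isCoboundedUnder_le
    (show A + B < limsup _ _ by rw [← alexandrovAngle, ← hγ]; linarith)
  have key : ∀ {P : ℝ × ℝ → Prop}, (∀ᶠ z in 𝓝[>] (0 : ℝ) ×ˢ 𝓝[>] (0 : ℝ), P z) →
      ∃ ε > 0, ∀ s t : ℝ, 0 < s → s ≤ ε → 0 < t → t ≤ ε → P (s, t) := by
    intro P hP
    obtain ⟨U, hU, V, hV, hUV⟩ := Filter.mem_prod_iff.1 hP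
    obtain ⟨a, ha, haU⟩ := mem_nhdsGT_iff_exists_Ioc_subset.1 hU
    obtain ⟨b, hb, hbV⟩ := mem_nhdsGT_iff_exists_Ioc_subset.1 hV
    exact ⟨min a b, lt_min ha hb, fun s t hs hs' ht ht' =>
      hUV ⟨haU ⟨hs, hs'.trans (min_le_left _ _)⟩, hbV ⟨ht, ht'.trans (min_le_right _ _)⟩⟩⟩
  obtain ⟨ε1, hε1, H1⟩ := key e1
  obtain ⟨ε2, hε2, H2⟩ := key e2
  set ε := min (min ε1 ε2) (min (min c.length c'.length) c''.length) with hε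
  have hε0 : 0 < ε := lt_min (lt_min hε1 hε2)
    (lt_min (lt_min c.length_pos c'.length_pos) c''.length_pos)
  have hεε1 : ε ≤ ε1 := (min_le_left _ _).trans (min_le_left _ _)
  have hεε2 : ε ≤ ε2 := (min_le_left _ _).trans (min_le_right _ _)
  have hεc : ε ≤ c.length :=
    (min_le_right _ _).trans ((min_le_left _ _).trans (min_le_left _ _))
  have hεc' : ε ≤ c'.length :=
    (min_le_right _ _).trans ((min_le_left _ _).trans (min_le_right _ _))
  have hεc'' : ε ≤ c''.length := (min_le_right _ _).trans (min_le_right _ _)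
  have hsmall : ∀ᶠ z in 𝓝[>] (0 : ℝ) ×ˢ 𝓝[>] (0 : ℝ),
      (0 < z.1 ∧ z.1 ≤ ε) ∧ (0 < z.2 ∧ z.2 ≤ ε) :=
    Eventually.prod_mk (Ioc_mem_nhdsGT hε0) (Ioc_mem_nhdsGT hε0)
  obtain ⟨⟨r, t⟩, hrt, ⟨hr, hrε⟩, ht, htε⟩ := (e3.and_eventually hsmall).exists
  simp only at hrt hr hrε ht htε
  set S := r * Real.sin A + t * Real.sin B with hS
  have hS0 : 0 < S := by positivity
  set s := r * t * Real.sin (A + B) / S with hs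
  have hs0 : 0 < s := by positivity
  have hsε : s ≤ ε := by
    rw [hs, div_le_iff₀ hS0, Real.sin_add A B, hS]
    have i1 : Real.sin A * Real.cos B ≤ Real.sin A :=
      mul_le_of_le_one_right hsA.le (Real.cos_le_one _)
    have i2 : Real.cos A * Real.sin B ≤ Real.sin B :=
      mul_le_of_le_one_left hsB.le (Real.cos_le_one _)
    calc r * t * (Real.sin A * Real.cos B + Real.cos A * Real.sin B)
        ≤ r * t * (Real.sin A + Real.sin B) := by gcongr
      _ = t * (r * Real.sin A) + r * (t * Real.sin B) := by ring
      _ ≤ ε * (r * Real.sin A) + ε * (t * Real.sin B) := by gcongr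
      _ = _ := by ring
  have b1 := c.dist_bounds c' hr (hrε.trans hεc) hs0 (hsε.trans hεc')
  have b2 := c'.dist_bounds c'' hs0 (hsε.trans hεc') ht (htε.trans hεc'')
  have b3 := c.dist_bounds c'' hr (hrε.trans hεc) ht (htε.trans hεc'')
  have d1 : dist (c.toFun r) (c'.toFun s) ≤ thirdSide r s A := by
    rw [← cos_comparisonAngle hr hs0 b1.1 b1.2]
    exact thirdSide_mono hr.le hs0.le (comparisonAngle_nonneg _ _ _)
      (H1 r s hr (hrε.trans hεε1) hs0 (hsε.trans hεε1)).le (by linarith)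
  have d2 : dist (c'.toFun s) (c''.toFun t) ≤ thirdSide s t B := by
    rw [← cos_comparisonAngle hs0 ht b2.1 b2.2]
    exact thirdSide_mono hs0.le ht.le (comparisonAngle_nonneg _ _ _)
      (H2 s t hs0 (hsε.trans hεε2) ht (htε.trans hεε2)).le (by linarith)
  have d3 : thirdSide r t (A + B) < dist (c.toFun r) (c''.toFun t) := by
    rw [← cos_comparisonAngle hr ht b3.1 b3.2]
    have hcos : Real.cos (comparisonAngle r t (dist (c.toFun r) (c''.toFun t)))
        < Real.cos (A + B) :=
      Real.cos_lt_cos_of_nonneg_of_le_pi (by linarith) (comparisonAngle_le_pi _ _ _) hrt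
    apply Real.sqrt_lt_sqrt
    · have : Real.cos (A + B) ≤ 1 := Real.cos_le_one _
      nlinarith [mul_pos hr ht, sq_nonneg (r - t)]
    · have := mul_lt_mul_of_pos_left hcos (by positivity : 0 < 2 * r * t)
      linarith
  have hcol : thirdSide r s A + thirdSide s t B = thirdSide r t (A + B) := by
    rw [thirdSide_eq_norm r t A B, thirdSide_eq_norm_left, thirdSide_eq_norm_right]
    rw [← dist_eq_norm, ← dist_eq_norm, ← dist_eq_norm]
    apply dist_add_dist_of_mem_segment
    refine ⟨t * Real.sin B / S, r * Real.sin A / S, by positivity, by positivity, ?_, ?_⟩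
    · rw [← add_div, add_comm, ← hS, div_self hS0.ne']
    · apply Complex.ext
      · simp only [Complex.add_re, Complex.real_smul, Complex.mul_re, Complex.ofReal_re,
          Complex.ofReal_im, zero_mul, sub_zero]
        rw [hs, Real.sin_add A B]; ring
      · simp only [Complex.add_im, Complex.real_smul, Complex.mul_im, Complex.ofReal_re,
          Complex.ofReal_im, zero_mul, add_zero]
        ring
  have := dist_triangle (c.toFun r) (c'.toFun s) (c''.toFun t)
  linarith

end Helpers

/-! ### Tangent cones -/

/-- Representatives of the points of the tangent cone at `p`: the origin, and the vectors of length
`r ≥ 0` in the direction of a geodesic issuing from `p`. -/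
inductive TangentVector {X : Type u} [MetricSpace X] (p : X) : Type u
  | origin : TangentVector p
  | ray (r : ℝ≥0) (c : GeodesicFrom p) : TangentVector p

namespace TangentVector

variable {X : Type u} [MetricSpace X] {p : X}

/-- The distance of the Euclidean cone over the space of directions at `p`. -/
noncomputable def coneDist : TangentVector p → TangentVector p → ℝ
  | origin, origin => 0
  | origin, ray s _ => s
  | ray r _, origin => r
  | ray r c, ray s c' =>
      Real.sqrt ((r : ℝ) ^ 2 + (s : ℝ) ^ 2 - 2 * r * s * Real.cos (alexandrovAngle c c'))

theorem coneDist_ray (r s : ℝ≥0) (c c' : GeodesicFrom p) :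
    coneDist (ray r c) (ray s c') = thirdSide r s (alexandrovAngle c c') := rfl

theorem thirdSide_le_add {r s : ℝ} (hr : 0 ≤ r) (hs : 0 ≤ s) (a : ℝ) :
    thirdSide r s a ≤ r + s := by
  rw [thirdSide, Real.sqrt_le_left (by positivity)]
  nlinarith [Real.neg_one_le_cos a, mul_nonneg hr hs]

theorem abs_sub_le_thirdSide {r s : ℝ} (hr : 0 ≤ r) (hs : 0 ≤ s) (a : ℝ) :
    |r - s| ≤ thirdSide r s a := by
  apply Real.le_sqrt_of_sq_le
  rw [sq_abs]
  nlinarith [Real.cos_le_one a, mul_nonneg hr hs]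

theorem coneDist_self (u : TangentVector p) : coneDist u u = 0 := by
  cases u with
  | origin => rfl
  | ray r c =>
    rw [coneDist_ray, alexandrovAngle_self, thirdSide, Real.cos_zero]
    rw [show (r : ℝ) ^ 2 + (r : ℝ) ^ 2 - 2 * r * r * 1 = 0 by ring, Real.sqrt_zero]

theorem coneDist_comm (u w : TangentVector p) : coneDist u w = coneDist w u := by
  cases u with
  | origin => cases w <;> rfl
  | ray r c =>
    cases w with
    | origin => rfl
    | ray s c' =>
      rw [coneDist_ray, coneDist_ray, alexandrovAngle_comm, thirdSide, thirdSide]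
      congr 1; ring

theorem coneDist_triangle (u v w : TangentVector p) :
    coneDist u w ≤ coneDist u v + coneDist v w := by
  rcases u with _ | ⟨r, c⟩ <;> rcases v with _ | ⟨s, c'⟩ <;> rcases w with _ | ⟨t, c''⟩
  · simp [coneDist]
  · simp [coneDist]
  · simp [coneDist]
  · have := (abs_le.1 (abs_sub_le_thirdSide s.2 t.2 (alexandrovAngle c' c''))).1
    rw [coneDist_ray]
    simp only [coneDist]
    simp only [NNReal.val_eq_coe] at this
    linarith
  · simp [coneDist]
  · rw [coneDist_ray]
    exact thirdSide_le_add r.2 t.2 _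
  · have := (abs_le.1 (abs_sub_le_thirdSide r.2 s.2 (alexandrovAngle c c'))).2
    rw [coneDist_ray]
    simp only [coneDist]
    simp only [NNReal.val_eq_coe] at this
    linarith
  · rw [coneDist_ray, coneDist_ray, coneDist_ray]
    exact thirdSide_triangle r.2 s.2 t.2 (alexandrovAngle_le_pi _ _)
      (alexandrovAngle_nonneg _ _) (alexandrovAngle_le_pi _ _) (alexandrovAngle_nonneg _ _)
      (alexandrovAngle_le_pi _ _) (alexandrovAngle_triangle _ _ _)

noncomputable instance : PseudoMetricSpace (TangentVector p) where
  dist := coneDist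
  dist_self := coneDist_self
  dist_comm := coneDist_comm
  dist_triangle := coneDist_triangle

end TangentVector

/-- The tangent cone at `p`: the Euclidean cone over the space of directions at `p`. -/
abbrev TangentCone {X : Type u} [MetricSpace X] (p : X) : Type u :=
  SeparationQuotient (TangentVector p)

namespace TangentCone

/-- The origin (cone point) of the tangent cone. -/
noncomputable def origin {X : Type u} [MetricSpace X] (p : X) : TangentCone p :=
  SeparationQuotient.mk TangentVector.origin

/-- The vector of length `r` in the direction of the geodesic `c`. -/
noncomputable def ray {X : Type u} [MetricSpace X] {p : X} (r : ℝ≥0) (c : GeodesicFrom p) : TangentCone p :=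
  SeparationQuotient.mk (TangentVector.ray r c)

end TangentCone

/-! ### Distortion and radial distortion -/

/-- `f` is `1`-Lipschitz and shrinks distances at most by the factor `D`. -/
def HasDistortion {T H : Type u} [PseudoMetricSpace T] [NormedAddCommGroup H]
    (f : T → H) (D : ℝ) : Prop :=
  ∀ v w : T, dist v w / D ≤ ‖f v - f w‖ ∧ ‖f v - f w‖ ≤ dist v w

/-- The (Hilbert space) distortion of `T`, which is `∞` if there is no admissible map. -/
noncomputable def distortion (T : Type u) [PseudoMetricSpace T] : ℝ≥0∞ :=
  sInf {E | ∃ D : ℝ, 0 < D ∧ E = ENNReal.ofReal D ∧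
    ∃ (H : Type u) (_ : NormedAddCommGroup H) (_ : InnerProductSpace ℝ H) (_ : CompleteSpace H)
      (f : T → H), HasDistortion f D}

/-- The radial distortion of a metric cone `T` with origin `O`, which is `∞` if there is no
admissible map. -/
noncomputable def radialDistortion (T : Type u) [PseudoMetricSpace T] (O : T) : ℝ≥0∞ :=
  sInf {E | ∃ D : ℝ, 0 < D ∧ E = ENNReal.ofReal D ∧
    ∃ (H : Type u) (_ : NormedAddCommGroup H) (_ : InnerProductSpace ℝ H) (_ : CompleteSpace H)
      (f : T → H), (∀ v, ‖f v‖ = dist O v) ∧ HasDistortion f D}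

/-! ### Directions in the cubes -/

namespace CubeComplex

variable {X : Type u} [MetricSpace X]

/-- Near its origin, the geodesic `c` is the straight segment in the cube `a` that starts at the
point `x` of this cube and has velocity `v`. -/
def StartsAs (K : CubeComplex.{u, v} X) {p : X} (c : GeodesicFrom p) (a : K.Cell)
    (x v : EuclideanSpace ℝ (Fin (K.dim a))) : Prop :=
  ∀ᶠ t in 𝓝[>] (0 : ℝ), x + t • v ∈ unitCube (K.dim a) ∧ c.toFun t = K.char a (x + t • v)

/-- `u` is the unit vector in the tangent cone at `p` in the direction of an edge with endpoint
`p`: there are a cube `a` and a vertex `x` of it that is mapped to `p`, such that `u` is the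
direction of the edge of `a` that starts at `x` and is parallel to the `i`-th axis. -/
def IsEdgeDirection (K : CubeComplex.{u, v} X) (p : X) (u : TangentCone p) : Prop :=
  ∃ (a : K.Cell) (x : EuclideanSpace ℝ (Fin (K.dim a))) (i : Fin (K.dim a)) (c : GeodesicFrom p),
    (∀ j, x j = 0 ∨ x j = 1) ∧ K.char a x = p ∧
    K.StartsAs c a x (EuclideanSpace.single i (1 - 2 * x i)) ∧ u = TangentCone.ray 1 c

end CubeComplex

/-! Choose `ε > 0` so that each coordinate of each preimage of `p` in any cube is `0`, `1`, or at
least `ε` away from both. Near `p` the complex is then a union of charts, each the product of an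
orthant and a Euclidean factor. The Euclidean factor is tangent to the open face of `p` and is
common to all charts; the axes of the orthants are the edges at `p`.

Take a Hilbert space with one orthonormal vector per edge, together with an orthonormal basis of the
Euclidean factor. Every chart maps to it linearly and isometrically, and these maps agree on common
faces (`develop_eq_of_exp_eq`). Let `g c` be the image of the initial velocity of a geodesic `c`;
the required map is the radial extension of `g`.

The metric is an infimum of lengths of strings, so the glued map is `1`-Lipschitz near `p`
(`norm_map_sub_le`). Hence the cosine of the angle of `c, c'` is at most `⟨g c, g c'⟩`. For a
converse, split vectors `v, w` of two charts into their parts `vm, wm` along the common directions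
and the remainders `v₁, w₁` along unshared edges. Some path through the common face has squared
length `‖vm - wm‖² + (‖v₁‖ + ‖w₁‖)²`, which by Cauchy-Schwarz is at most `(‖v‖ + ‖w‖)² - 4⟨v, w⟩`
(`dist_sq_le`). Hence the cosine is at least `2⟨g c, g c'⟩ - 1`. Since `2rs ≤ r² + s²`, the squared
cone distance is at most twice the squared Hilbert distance, which is the constant `√2`.

The CAT(0) condition is used through uniqueness of geodesics. It shows that no edge occurs twice in
a chart (`label_injective`), that the image of a small vector determines its point, so that charts
with common edges share the face spanned by them (`exp_eq_of_map_eq`, in the role of the flag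
condition on links), and that geodesics issuing from `p` start as straight segments
(`exists_startsAs`). -/

/-! ### Points of the cube and their faces -/

section CubeGeometry

variable {n m : ℕ}

/-- The coordinates of `z` different from `0` and `1` have distance at least `ε` to `0` and `1`. -/
def IsClear (ε : ℝ) (z : EuclideanSpace ℝ (Fin n)) : Prop :=
  ∀ i, z i = 0 ∨ z i = 1 ∨ (ε ≤ z i ∧ z i ≤ 1 - ε)

/-- Every point of `S` can be reflected in `z` to a point of `S` at distance `ε` from `z`. -/
def ReflectsAt (ε : ℝ) (S : Set (EuclideanSpace ℝ (Fin n))) (z : EuclideanSpace ℝ (Fin n)) :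
    Prop :=
  ∀ y ∈ S, ∃ y' ∈ S, ‖y' - z‖ ≤ ε ∧ inner ℝ (y - z) (y' - z) = -(ε * ‖y - z‖)

theorem abs_coord_le_norm (x : EuclideanSpace ℝ (Fin n)) (i : Fin n) : |x i| ≤ ‖x‖ :=
  PiLp.norm_apply_le x i

theorem mem_cubeSupport_self {x : EuclideanSpace ℝ (Fin n)} (hx : x ∈ unitCube n) :
    x ∈ cubeSupport x :=
  ⟨hx, fun _ => ⟨id, id⟩⟩

theorem exists_isClear (x : EuclideanSpace ℝ (Fin n)) (hx : x ∈ unitCube n) :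
    ∃ ε, 0 < ε ∧ ε ≤ 1 / 2 ∧ IsClear ε x := by
  have h : ∀ i, ∃ ε, 0 < ε ∧ ε ≤ 1 / 2 ∧ (x i = 0 ∨ x i = 1 ∨ (ε ≤ x i ∧ x i ≤ 1 - ε)) := by
    intro i
    rcases eq_or_lt_of_le (hx i).1 with h0 | h0
    · exact ⟨1 / 2, by norm_num, le_rfl, Or.inl h0.symm⟩
    rcases eq_or_lt_of_le (hx i).2 with h1 | h1
    · exact ⟨1 / 2, by norm_num, le_rfl, Or.inr (Or.inl h1)⟩
    refine ⟨min (1 / 2) (min (x i) (1 - x i)), by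
      refine lt_min (by norm_num) (lt_min h0 (by linarith)), min_le_left _ _, Or.inr (Or.inr ⟨?_, ?_⟩)⟩
    · exact (min_le_right _ _).trans (min_le_left _ _)
    · have : min (1 / 2) (min (x i) (1 - x i)) ≤ 1 - x i :=
        (min_le_right _ _).trans (min_le_right _ _)
      linarith
  choose e he0 he1 he using h
  let s : Finset ℝ := insert (1 / 2) (Finset.univ.image e)
  have hs : s.Nonempty := ⟨1 / 2, by simp [s]⟩
  refine ⟨s.min' hs, ?_, s.min'_le _ (by simp [s]), fun i => ?_⟩
  · rw [Finset.lt_min'_iff]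
    intro y hy
    simp only [s, Finset.mem_insert, Finset.mem_image, Finset.mem_univ, true_and] at hy
    rcases hy with rfl | ⟨i, rfl⟩
    · norm_num
    · exact he0 i
  · have : s.min' hs ≤ e i := s.min'_le _ (by simp [s])
    rcases he i with h | h | ⟨h, h'⟩
    · exact Or.inl h
    · exact Or.inr (Or.inl h)
    · exact Or.inr (Or.inr ⟨by linarith, by linarith⟩)

/-- Inside the support of `z` only coordinates other than `0` and `1` can move, and these have room
`ε` on both sides; so the step of length `ε` from `z` away from `y` stays in the face. -/
theorem IsClear.reflectsAt {ε : ℝ} {z : EuclideanSpace ℝ (Fin n)} (hε : 0 < ε)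
    (hz : IsClear ε z) (hzc : z ∈ unitCube n) : ReflectsAt ε (cubeSupport z) z := by
  intro y hy
  by_cases hyz : y = z
  · exact ⟨z, mem_cubeSupport_self hzc, by simp [hε.le], by simp [hyz]⟩
  have hpos : 0 < ‖y - z‖ := norm_pos_iff.2 (sub_ne_zero.2 hyz)
  have hnorm : ‖-((ε / ‖y - z‖) • (y - z))‖ = ε := by
    rw [norm_neg, norm_smul, Real.norm_of_nonneg (by positivity), div_mul_cancel₀ _ hpos.ne']
  refine ⟨z + -((ε / ‖y - z‖) • (y - z)), ?_, by rw [add_sub_cancel_left, hnorm], ?_⟩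
  · have hfix : ∀ i, y i = z i → (z + -((ε / ‖y - z‖) • (y - z))) i = z i := by
      intro i hi
      simp [hi]
    have hle : ∀ i, |(z + -((ε / ‖y - z‖) • (y - z))) i - z i| ≤ ε := by
      intro i
      have := abs_coord_le_norm (-((ε / ‖y - z‖) • (y - z))) i
      rw [hnorm] at this
      simpa using this
    refine ⟨fun i => ?_, fun i => ⟨fun h => ?_, fun h => ?_⟩⟩
    · rcases hz i with h | h | h
      · rw [hfix i (by rw [h, (hy.2 i).1 h])]; exact hzc i
      · rw [hfix i (by rw [h, (hy.2 i).2 h])]; exact hzc i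
      · have := abs_le.1 (hle i)
        constructor <;> linarith
    · rw [hfix i (by rw [h, (hy.2 i).1 h]), h]
    · rw [hfix i (by rw [h, (hy.2 i).2 h]), h]
  · rw [add_sub_cancel_left, inner_neg_right, inner_smul_right, real_inner_self_eq_norm_sq]
    field_simp

theorem ReflectsAt.coord {ε : ℝ} {S : Set (EuclideanSpace ℝ (Fin n))}
    {w : EuclideanSpace ℝ (Fin n)} (h : ReflectsAt ε S w) {i : Fin n} {c : ℝ}
    (hS : w + EuclideanSpace.single i c ∈ S) :
    ∃ y' ∈ S, c * (y' i - w i) = -(ε * |c|) := by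
  obtain ⟨y', hy', -, h2⟩ := h _ hS
  refine ⟨y', hy', ?_⟩
  rw [add_sub_cancel_left, EuclideanSpace.inner_single_left, PiLp.norm_single] at h2
  simpa using h2

/-- Test the reflection on the points of the face whose `i`-th coordinate is moved to `1` or to `0`:
their reflections lie `ε` beyond `w` on the other side, still in the cube. With `IsClear.reflectsAt`
this makes clearance a metric property of a face and a point of it, hence invariant under
isometries. -/
theorem ReflectsAt.clear {ε : ℝ} {z w : EuclideanSpace ℝ (Fin n)} (hε : 0 < ε)
    (hw : w ∈ cubeSupport z) (h : ReflectsAt ε (cubeSupport z) w) (i : Fin n)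
    (h0 : z i ≠ 0) (h1 : z i ≠ 1) : ε ≤ w i ∧ w i ≤ 1 - ε := by
  have hmem : ∀ c : ℝ, 0 ≤ w i + c → w i + c ≤ 1 →
      w + EuclideanSpace.single i c ∈ cubeSupport z := by
    intro c hc0 hc1
    refine ⟨fun j => ?_, fun j => ?_⟩
    · by_cases hj : j = i
      · subst hj; simpa using ⟨hc0, hc1⟩
      · simpa [hj] using hw.1 j
    · by_cases hj : j = i
      · subst hj; exact ⟨fun h => absurd h h0, fun h => absurd h h1⟩
      · simpa [hj] using hw.2 j
  have hw01 := hw.1 i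
  -- Excluded separately, since otherwise the displacement `1 - w i` used next would be zero and
  -- carry no information.
  have hw1 : w i < 1 := by
    refine lt_of_le_of_ne hw01.2 fun hw1 => ?_
    obtain ⟨y', hy', he⟩ := h.coord (hmem (-1) (by rw [hw1]; norm_num) (by rw [hw1]; norm_num))
    have := (hy'.1 i).2
    simp at he
    linarith
  have hlow : ε ≤ w i := by
    have hc : 0 < 1 - w i := by linarith
    obtain ⟨y', hy', he⟩ := h.coord (hmem (1 - w i) (by linarith) (by linarith))
    rw [abs_of_pos hc] at he
    have : y' i - w i = -ε := by
      have : (1 - w i) * (y' i - w i + ε) = 0 := by linarith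
      rcases mul_eq_zero.1 this with h | h <;> linarith
    have := (hy'.1 i).1
    linarith
  refine ⟨hlow, ?_⟩
  obtain ⟨y', hy', he⟩ := h.coord (hmem (-w i) (by linarith) (by linarith))
  rw [abs_neg, abs_of_pos (by linarith)] at he
  have : y' i - w i = ε := by
    have : w i * (y' i - w i - ε) = 0 := by linarith
    rcases mul_eq_zero.1 this with h | h <;> linarith
  have := (hy'.1 i).2
  linarith

theorem ReflectsAt.sameOpenFace {ε : ℝ} {z w : EuclideanSpace ℝ (Fin n)} (hε : 0 < ε)
    (hw : w ∈ cubeSupport z) (h : ReflectsAt ε (cubeSupport z) w) : SameOpenFace w z := by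
  intro i
  by_cases h0 : z i = 0
  · simp [h0, (hw.2 i).1 h0]
  by_cases h1 : z i = 1
  · simp [h1, (hw.2 i).2 h1]
  have := h.clear hε hw i h0 h1
  simp only [h0, h1, iff_false]
  constructor <;> intro h' <;> rw [h'] at this <;> linarith

/-- Where `x` has a coordinate `0` or `1`, that of `z` is less than `ε` away, and clearance leaves
it only the same value. So points close to a preimage of `p` lie in open faces whose closure
contains this preimage. -/
theorem mem_cubeSupport_of_norm_sub_lt {ε : ℝ} {x z : EuclideanSpace ℝ (Fin n)} (hε : ε ≤ 1 / 2)
    (hz : IsClear ε z) (hzc : z ∈ unitCube n) (h : ‖x - z‖ < ε) : z ∈ cubeSupport x := by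
  refine ⟨hzc, fun i => ?_⟩
  have := abs_lt.1 ((abs_coord_le_norm (x - z) i).trans_lt h)
  simp only [PiLp.sub_apply] at this
  rcases hz i with h | h | h
  · refine ⟨fun _ => h, fun hx => ?_⟩
    rw [h, hx] at this; linarith
  · refine ⟨fun hx => ?_, fun _ => h⟩
    rw [h, hx] at this; linarith
  · constructor <;> intro hx <;> rw [hx] at this <;> linarith

theorem sameOpenFace_of_mem_cubeSupport {x z : EuclideanSpace ℝ (Fin n)} (h : z ∈ cubeSupport x)
    (h' : x ∈ cubeSupport z) : SameOpenFace x z :=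
  fun i => ⟨⟨(h.2 i).1, (h'.2 i).1⟩, ⟨(h.2 i).2, (h'.2 i).2⟩⟩

end CubeGeometry

/-! ### Gluing isometries and the metric near `p`. -/

namespace CubeComplex

variable {X : Type u} [MetricSpace X] (K : CubeComplex.{u, v} X)

/-- `h` is an isometry, with inverse `g`, from the support of `x` onto the support of `y`, which
sends `x` to `y` and is compatible with the characteristic maps. -/
structure IsFaceIso {a b : K.Cell} (x : EuclideanSpace ℝ (Fin (K.dim a)))
    (y : EuclideanSpace ℝ (Fin (K.dim b)))
    (h : EuclideanSpace ℝ (Fin (K.dim a)) → EuclideanSpace ℝ (Fin (K.dim b)))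
    (g : EuclideanSpace ℝ (Fin (K.dim b)) → EuclideanSpace ℝ (Fin (K.dim a))) : Prop where
  mapsTo : ∀ w ∈ cubeSupport x, h w ∈ cubeSupport y
  mapsTo_inv : ∀ w ∈ cubeSupport y, g w ∈ cubeSupport x
  left_inv : ∀ w ∈ cubeSupport x, g (h w) = w
  right_inv : ∀ w ∈ cubeSupport y, h (g w) = w
  dist_map : ∀ w ∈ cubeSupport x, ∀ w' ∈ cubeSupport x, dist (h w) (h w') = dist w w'
  char_map : ∀ w ∈ cubeSupport x, K.char b (h w) = K.char a w
  map_base : h x = y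

variable {K}

theorem IsFaceIso.inner_map {a b : K.Cell} {x : EuclideanSpace ℝ (Fin (K.dim a))}
    {y : EuclideanSpace ℝ (Fin (K.dim b))} {h g} (H : K.IsFaceIso x y h g)
    {z u w : EuclideanSpace ℝ (Fin (K.dim a))}
    (hz : z ∈ cubeSupport x) (hu : u ∈ cubeSupport x) (hw : w ∈ cubeSupport x) :
    inner ℝ (h u - h z) (h w - h z) = inner ℝ (u - z) (w - z) := by
  have e1 := H.dist_map u hu z hz
  have e2 := H.dist_map w hw z hz
  have e3 := H.dist_map u hu w hw
  rw [dist_eq_norm, dist_eq_norm] at e1 e2 e3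
  rw [real_inner_eq_norm_mul_self_add_norm_mul_self_sub_norm_sub_mul_self_div_two,
    real_inner_eq_norm_mul_self_add_norm_mul_self_sub_norm_sub_mul_self_div_two]
  rw [sub_sub_sub_cancel_right, sub_sub_sub_cancel_right, e1, e2, e3]

theorem IsFaceIso.norm_map {a b : K.Cell} {x : EuclideanSpace ℝ (Fin (K.dim a))}
    {y : EuclideanSpace ℝ (Fin (K.dim b))} {h g} (H : K.IsFaceIso x y h g)
    {z u : EuclideanSpace ℝ (Fin (K.dim a))}
    (hz : z ∈ cubeSupport x) (hu : u ∈ cubeSupport x) : ‖h u - h z‖ = ‖u - z‖ := by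
  rw [← dist_eq_norm, ← dist_eq_norm, H.dist_map u hu z hz]

/-- The gluing axiom does not say that the isometry sends `x` to `y`. But an isometry preserves
reflectability, so the image of `x` is in the open face of `y`; as it is also glued to `y`, it
equals `y` by `inj`. The same argument carries the clearance of `x` over to `y`. -/
theorem exists_isFaceIso {a b : K.Cell} {x : EuclideanSpace ℝ (Fin (K.dim a))}
    {y : EuclideanSpace ℝ (Fin (K.dim b))} (hx : x ∈ unitCube (K.dim a))
    (hy : y ∈ unitCube (K.dim b)) (hxy : K.char a x = K.char b y) :
    (∃ h g, K.IsFaceIso x y h g) ∧ ∀ ε > 0, IsClear ε x → IsClear ε y := by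
  obtain ⟨e, he⟩ := K.glue a b x hx y hy hxy
  classical
  -- The values `y` and `x` off the supports are placeholders that are never used.
  let h : EuclideanSpace ℝ (Fin (K.dim a)) → EuclideanSpace ℝ (Fin (K.dim b)) :=
    fun w => if hw : w ∈ cubeSupport x then e ⟨w, hw⟩ else y
  let g : EuclideanSpace ℝ (Fin (K.dim b)) → EuclideanSpace ℝ (Fin (K.dim a)) :=
    fun w => if hw : w ∈ cubeSupport y then e.symm ⟨w, hw⟩ else x
  have hh : ∀ w (hw : w ∈ cubeSupport x), h w = e ⟨w, hw⟩ := fun w hw => dif_pos hw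
  have hg : ∀ w (hw : w ∈ cubeSupport y), g w = e.symm ⟨w, hw⟩ := fun w hw => dif_pos hw
  have hxs := mem_cubeSupport_self hx
  have hmaps : ∀ w ∈ cubeSupport x, h w ∈ cubeSupport y := fun w hw => by
    rw [hh w hw]; exact (e ⟨w, hw⟩).2
  have hmaps' : ∀ w ∈ cubeSupport y, g w ∈ cubeSupport x := fun w hw => by
    rw [hg w hw]; exact (e.symm ⟨w, hw⟩).2
  have hleft : ∀ w ∈ cubeSupport x, g (h w) = w := fun w hw => by
    rw [hg _ (hmaps w hw)]
    have : (⟨h w, hmaps w hw⟩ : cubeSupport y) = e ⟨w, hw⟩ := Subtype.ext (hh w hw)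
    rw [this, e.symm_apply_apply]
  have hright : ∀ w ∈ cubeSupport y, h (g w) = w := fun w hw => by
    rw [hh _ (hmaps' w hw)]
    have : (⟨g w, hmaps' w hw⟩ : cubeSupport x) = e.symm ⟨w, hw⟩ := Subtype.ext (hg w hw)
    rw [this, e.apply_symm_apply]
  have hdist : ∀ w ∈ cubeSupport x, ∀ w' ∈ cubeSupport x, dist (h w) (h w') = dist w w' :=
    fun w hw w' hw' => by
      rw [hh w hw, hh w' hw', ← Subtype.dist_eq, e.dist_eq, Subtype.dist_eq]
  have hchar : ∀ w ∈ cubeSupport x, K.char b (h w) = K.char a w := fun w hw => by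
    rw [hh w hw, ← he ⟨w, hw⟩]
  have hinner : ∀ u ∈ cubeSupport x, ∀ w ∈ cubeSupport x,
      inner ℝ (h u - h x) (h w - h x) = inner ℝ (u - x) (w - x) := fun u hu w hw => by
    have e1 := hdist u hu x hxs
    have e2 := hdist w hw x hxs
    have e3 := hdist u hu w hw
    rw [dist_eq_norm, dist_eq_norm] at e1 e2 e3
    rw [real_inner_eq_norm_mul_self_add_norm_mul_self_sub_norm_sub_mul_self_div_two,
      real_inner_eq_norm_mul_self_add_norm_mul_self_sub_norm_sub_mul_self_div_two]
    rw [sub_sub_sub_cancel_right, sub_sub_sub_cancel_right, e1, e2, e3]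
  have hrefl : ∀ ε > 0, IsClear ε x → ReflectsAt ε (cubeSupport y) (h x) := by
    intro ε hε hcl w hw
    obtain ⟨y', hy', h1, h2⟩ := hcl.reflectsAt hε hx (g w) (hmaps' w hw)
    refine ⟨h y', hmaps y' hy', ?_, ?_⟩
    · rwa [← dist_eq_norm, hdist y' hy' x hxs, dist_eq_norm]
    · have h3 := hinner (g w) (hmaps' w hw) y' hy'
      rw [hright w hw] at h3
      rw [h3, h2, ← dist_eq_norm (g w), ← hdist _ (hmaps' w hw) x hxs, hright w hw, dist_eq_norm]
  have hbase : h x = y := by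
    obtain ⟨ε, hε, -, hcl⟩ := exists_isClear x hx
    exact K.inj b _ (hmaps x hxs).1 y hy ((hrefl ε hε hcl).sameOpenFace hε (hmaps x hxs))
      (by rw [hchar x hxs, hxy])
  refine ⟨⟨h, g, hmaps, hmaps', hleft, hright, hdist, hchar, hbase⟩, fun ε hε hcl i => ?_⟩
  by_cases h0 : y i = 0
  · exact Or.inl h0
  by_cases h1 : y i = 1
  · exact Or.inr (Or.inl h1)
  have := hrefl ε hε hcl
  rw [hbase] at this
  exact Or.inr (Or.inr (this.clear hε (mem_cubeSupport_self hy) i h0 h1))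

theorem dist_char_le {a : K.Cell} {x y : EuclideanSpace ℝ (Fin (K.dim a))}
    (hx : x ∈ unitCube (K.dim a)) (hy : y ∈ unitCube (K.dim a)) :
    dist (K.char a x) (K.char a y) ≤ ‖x - y‖ := by
  have := (K.isGLB_dist (K.char a x) (K.char a y)).1 (IsCubeString.cons a x y _ 0 hx hy (.nil _))
  rwa [add_zero, dist_eq_norm] at this

/-- A uniform clearance of the preimages of `p` in the cubes. -/
structure IsClearance (K : CubeComplex.{u, v} X) (p : X) (ε : ℝ) : Prop where
  pos : 0 < ε
  le_half : ε ≤ 1 / 2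
  isClear : ∀ a, ∀ z ∈ unitCube (K.dim a), K.char a z = p → IsClear ε z

/-- One preimage of `p` has a positive clearance because its coordinates are finite in number.
Gluing isometries transport it to all other preimages, so it is uniform even over infinitely many
cubes of unbounded dimension. -/
theorem exists_isClearance (K : CubeComplex.{u, v} X) (p : X) : ∃ ε, K.IsClearance p ε := by
  obtain ⟨a, x, hx, hp⟩ := K.cover p
  obtain ⟨ε, h0, h1, h2⟩ := exists_isClear x hx
  exact ⟨ε, h0, h1, fun b z hz hzp =>
    (exists_isFaceIso hx hz (hp.trans hzp.symm)).2 ε h0 h2⟩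

variable {p : X} {ε : ℝ}

theorem IsClearance.mem_cubeSupport (hε : K.IsClearance p ε) {a : K.Cell}
    {x z : EuclideanSpace ℝ (Fin (K.dim a))} (hz : z ∈ unitCube (K.dim a))
    (hzp : K.char a z = p) (h : ‖x - z‖ < ε) : z ∈ cubeSupport x :=
  mem_cubeSupport_of_norm_sub_lt hε.le_half (hε.isClear a z hz hzp) hz h

theorem IsClearance.eq_of_norm_sub_lt (hε : K.IsClearance p ε) {a : K.Cell}
    {z z' : EuclideanSpace ℝ (Fin (K.dim a))} (hz : z ∈ unitCube (K.dim a))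
    (hzp : K.char a z = p) (hz' : z' ∈ unitCube (K.dim a))
    (hzp' : K.char a z' = p) (h : ‖z - z'‖ < ε) : z = z' :=
  K.inj a z hz z' hz' (sameOpenFace_of_mem_cubeSupport (hε.mem_cubeSupport hz' hzp' h)
    (hε.mem_cubeSupport hz hzp (by rwa [norm_sub_rev]))) (hzp.trans hzp'.symm)

/-- A string to `p` shorter than `ε` can be straightened into the first cube: the preimage of `p`
found for the tail is so near that it lies in the support of the current point, and the gluing
isometry moves it to any other cube containing that point. -/
theorem IsClearance.exists_preimage_of_string (hε : K.IsClearance p ε) {q r : X} {l : ℝ}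
    (hs : IsCubeString K.dim K.char q r l) (hr : r = p) :
    l < ε → ∀ a, ∀ x ∈ unitCube (K.dim a), K.char a x = q →
      ∃ z ∈ unitCube (K.dim a), K.char a z = p ∧ ‖x - z‖ ≤ l := by
  induction hs with
  | nil q =>
    intro _ a x hx hxq
    exact ⟨x, hx, hxq.trans hr, by simp⟩
  | cons b x' y' q l hx' hy' _ ih =>
    intro hl a x hx hxq
    obtain ⟨z, hz, hzp, hzl⟩ := ih hr (by linarith [dist_nonneg (x := x') (y := y')]) b y' hy' rfl
    have hxz : ‖x' - z‖ ≤ dist x' y' + l := by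
      rw [dist_eq_norm]
      exact (norm_sub_le_norm_sub_add_norm_sub x' y' z).trans (by linarith)
    obtain ⟨h, g, H⟩ := (exists_isFaceIso hx' hx hxq.symm).1
    have hzs := hε.mem_cubeSupport hz hzp (hxz.trans_lt hl)
    refine ⟨h z, (H.mapsTo z hzs).1, (H.char_map z hzs).trans hzp, ?_⟩
    rw [← H.map_base, ← dist_eq_norm, H.dist_map _ (mem_cubeSupport_self hx') z hzs, dist_eq_norm]
    exact hxz

theorem exists_string_lt (K : CubeComplex.{u, v} X) {q r : X} {ρ : ℝ} (h : dist q r < ρ) :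
    ∃ l < ρ, IsCubeString K.dim K.char q r l := by
  by_contra! hcon
  refine absurd ((K.isGLB_dist q r).2 (show ρ ∈ lowerBounds _ from fun l hl => ?_)) (not_le.2 h)
  by_contra! hlt
  exact hcon l hlt hl

theorem IsClearance.exists_preimage (hε : K.IsClearance p ε) {ρ : ℝ} (hρ : ρ ≤ ε) {a : K.Cell}
    {x : EuclideanSpace ℝ (Fin (K.dim a))} (hx : x ∈ unitCube (K.dim a))
    (h : dist p (K.char a x) < ρ) :
    ∃ z ∈ unitCube (K.dim a), K.char a z = p ∧ ‖x - z‖ < ρ := by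
  rw [dist_comm] at h
  obtain ⟨l, hl, hs⟩ := K.exists_string_lt h
  obtain ⟨z, h1, h2, h3⟩ := hε.exists_preimage_of_string hs rfl (hl.trans_le hρ) a x hx rfl
  exact ⟨z, h1, h2, h3.trans_lt hl⟩

/-- Maps that are `1`-Lipschitz on the cubes near `p` are `1`-Lipschitz near `p`. -/
theorem IsClearance.dist_map_le (hε : K.IsClearance p ε) {M : Type*} [PseudoMetricSpace M]
    {ρ : ℝ} (hρ : ρ ≤ ε) (Ψ : X → M)
    (hΨ : ∀ a, ∀ z ∈ unitCube (K.dim a), K.char a z = p → ∀ x ∈ unitCube (K.dim a),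
      ∀ y ∈ unitCube (K.dim a), ‖x - z‖ < ρ → ‖y - z‖ < ρ →
      dist (Ψ (K.char a x)) (Ψ (K.char a y)) ≤ ‖x - y‖)
    {q r : X} (h : dist p q + dist q r < ρ) : dist (Ψ q) (Ψ r) ≤ dist q r := by
  have key : ∀ (q r : X) (l : ℝ), IsCubeString K.dim K.char q r l → dist p q + l < ρ →
      dist (Ψ q) (Ψ r) ≤ l := by
    intro q r l hs
    induction hs with
    | nil q => intro _; simp
    | cons a x y r l hx hy hs ih =>
      intro hl
      have hl0 : 0 ≤ l := dist_nonneg.trans ((K.isGLB_dist _ _).1 hs)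
      have hxy := dist_char_le hx hy
      rw [← dist_eq_norm] at hxy
      have ht := dist_triangle p (K.char a x) (K.char a y)
      -- The radius is reduced by `dist x y` so that the end point `y` of the step is also within
      -- `ρ` of the same `z`.
      obtain ⟨z, hz, hzp, hxz⟩ := hε.exists_preimage (ρ := ρ - dist x y)
        (by linarith [dist_nonneg (x := x) (y := y)]) hx (by linarith)
      have hyz : ‖y - z‖ < ρ := by
        have := norm_sub_le_norm_sub_add_norm_sub y x z
        rw [norm_sub_rev y x, ← dist_eq_norm x y] at this
        linarith
      have h1 := hΨ a z hz hzp x hx y hy (by linarith [dist_nonneg (x := x) (y := y)]) hyz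
      rw [← dist_eq_norm] at h1
      have h2 := ih (by linarith)
      exact (dist_triangle _ (Ψ (K.char a y)) _).trans (by linarith)
  refine le_of_forall_pos_lt_add fun η hη => ?_
  obtain ⟨l, hl, hs⟩ := K.exists_string_lt
    (show dist q r < min (dist q r + η) (ρ - dist p q) from lt_min (by linarith) (by linarith))
  have := key q r l hs (by linarith [hl.trans_le (min_le_right _ _)])
  linarith [hl.trans_le (min_le_left _ _)]

end CubeComplex

/-! ### Charts at a point and their transition maps -/

namespace CubeComplex

variable {X : Type u} [MetricSpace X]

/-- A cube together with a point of it that is mapped to `p`. -/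
structure Chart (K : CubeComplex.{u, v} X) (p : X) where
  /-- the cube -/
  cell : K.Cell
  /-- the point of the cube -/
  pt : EuclideanSpace ℝ (Fin (K.dim cell))
  mem : pt ∈ unitCube (K.dim cell)
  char_pt : K.char cell pt = p

variable {K : CubeComplex.{u, v} X} {p : X} {ε : ℝ}

namespace Chart

/-- The vectors of the cube, regarded as tangent vectors at the base point of the chart. -/
abbrev Vec (C : K.Chart p) : Type := EuclideanSpace ℝ (Fin (K.dim C.cell))

variable (C C' : K.Chart p)

/-- The point of the complex with coordinate vector `v` in the chart. -/
noncomputable def exp (v : C.Vec) : X := K.char C.cell (C.pt + v)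

/-- The base point lies on one of the two facets of the cube orthogonal to the `i`-th axis. -/
def Fixed (i : Fin (K.dim C.cell)) : Prop := C.pt i = 0 ∨ C.pt i = 1

/-- The sign of the coordinate `i` of vectors that point into the cube. -/
noncomputable def sgn (i : Fin (K.dim C.cell)) : ℝ := 1 - 2 * C.pt i

/-- The unit vector along the edge `i` that points into the cube. -/
noncomputable def edge (i : Fin (K.dim C.cell)) : C.Vec := EuclideanSpace.single i (C.sgn i)

/-- The tangent cone of the cube at the base point. -/
def InCone (v : C.Vec) : Prop := ∀ i, C.Fixed i → 0 ≤ C.sgn i * v i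

/-- The vectors whose end point lies in the smallest face containing the end point of `v`. -/
def face (v : C.Vec) : Set C.Vec := {u | C.pt + u ∈ cubeSupport (C.pt + v)}

variable {C C'}

theorem Fixed.sgn_mul_self {i : Fin (K.dim C.cell)} (h : C.Fixed i) : C.sgn i * C.sgn i = 1 := by
  unfold sgn
  rcases h with h | h <;> rw [h] <;> norm_num

theorem Fixed.abs_sgn {i : Fin (K.dim C.cell)} (h : C.Fixed i) : |C.sgn i| = 1 := by
  unfold sgn
  rcases h with h | h <;> rw [h] <;> norm_num

theorem Fixed.sgn_ne_zero {i : Fin (K.dim C.cell)} (h : C.Fixed i) : C.sgn i ≠ 0 :=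
  fun h0 => by have := h.sgn_mul_self; rw [h0] at this; norm_num at this

theorem Fixed.norm_edge {i : Fin (K.dim C.cell)} (h : C.Fixed i) : ‖C.edge i‖ = 1 := by
  rw [edge, PiLp.norm_single, Real.norm_eq_abs, h.abs_sgn]

theorem edge_apply_self (i : Fin (K.dim C.cell)) : C.edge i i = C.sgn i := by simp [edge]

theorem edge_apply_of_ne {i j : Fin (K.dim C.cell)} (h : j ≠ i) : C.edge i j = 0 := by
  simp [edge, h]

theorem inner_edge (v : C.Vec) (i : Fin (K.dim C.cell)) :
    inner ℝ v (C.edge i) = C.sgn i * v i := by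
  rw [edge, EuclideanSpace.inner_single_right]; simp

theorem inCone_zero : C.InCone 0 := fun i _ => by simp

theorem InCone.add {v w : C.Vec} (hv : C.InCone v) (hw : C.InCone w) : C.InCone (v + w) :=
  fun i hi => by
    have h1 := hv i hi
    have h2 := hw i hi
    rw [PiLp.add_apply, mul_add]; linarith

theorem InCone.smul {v : C.Vec} (hv : C.InCone v) {t : ℝ} (ht : 0 ≤ t) : C.InCone (t • v) :=
  fun i hi => by
    have := mul_nonneg ht (hv i hi)
    rw [PiLp.smul_apply, smul_eq_mul]; linarith

theorem inCone_edge (i : Fin (K.dim C.cell)) : C.InCone (C.edge i) := fun j hj => by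
  by_cases h : j = i
  · subst h; rw [edge_apply_self, hj.sgn_mul_self]; exact zero_le_one
  · rw [edge_apply_of_ne h, mul_zero]

theorem inCone_of_mem_unitCube {v : C.Vec} (h : C.pt + v ∈ unitCube _) : C.InCone v := by
  intro i hi
  have := h i
  rw [PiLp.add_apply] at this
  unfold sgn
  rcases hi with h | h <;> rw [h] at this ⊢ <;> linarith

theorem InCone.mem_unitCube (hε : K.IsClearance p ε) {v : C.Vec} (hv : C.InCone v)
    (h : ‖v‖ ≤ ε) : C.pt + v ∈ unitCube _ := by
  intro i
  have h1 := abs_le.1 ((abs_coord_le_norm v i).trans h)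
  have h2 := hε.le_half
  have h3 := hε.pos
  rw [PiLp.add_apply]
  rcases hε.isClear _ _ C.mem C.char_pt i with h | h | h
  · have := hv i (Or.inl h)
    rw [sgn, h] at this
    rw [h]
    constructor <;> linarith
  · have := hv i (Or.inr h)
    rw [sgn, h] at this
    rw [h]
    constructor <;> linarith
  · constructor <;> linarith

theorem exp_zero : C.exp 0 = p := by rw [exp, add_zero, C.char_pt]

theorem dist_exp_le {v w : C.Vec} (hv : C.pt + v ∈ unitCube _) (hw : C.pt + w ∈ unitCube _) :
    dist (C.exp v) (C.exp w) ≤ ‖v - w‖ := by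
  have := dist_char_le hv hw
  rwa [add_sub_add_left_eq_sub] at this

theorem mem_face_zero {u : C.Vec} :
    u ∈ C.face 0 ↔ C.pt + u ∈ unitCube _ ∧ ∀ i, C.Fixed i → u i = 0 := by
  simp only [face, add_zero, cubeSupport, Set.mem_ofPred_eq, PiLp.add_apply, Fixed]
  refine and_congr_right fun _ => forall_congr' fun i => ⟨?_, ?_⟩
  · rintro ⟨h0, h1⟩ (h | h)
    · have := h0 h; rw [h] at this; linarith
    · have := h1 h; rw [h] at this; linarith
  · intro h
    exact ⟨fun h0 => by rw [h (Or.inl h0), h0, add_zero],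
      fun h1 => by rw [h (Or.inr h1), h1, add_zero]⟩

/-- A vector shorter than `ε` can neither bring a coordinate that is not fixed to `0` or `1` nor
reach the opposite facet in a fixed one. So only the fixed coordinates where `v` vanishes constrain
its face. -/
theorem mem_face_iff (hε : K.IsClearance p ε) {v u : C.Vec} (hv : ‖v‖ < ε) :
    u ∈ C.face v ↔ C.pt + u ∈ unitCube _ ∧ ∀ i, C.Fixed i → v i = 0 → u i = 0 := by
  have h2 := hε.le_half
  simp only [face, cubeSupport, Set.mem_ofPred_eq, PiLp.add_apply]
  refine and_congr_right fun _ => forall_congr' fun i => ?_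
  have h1 := abs_lt.1 ((abs_coord_le_norm v i).trans_lt hv)
  constructor
  · rintro ⟨h0, h1⟩ (h | h) hvi
    · have := h0 (by rw [h, hvi, add_zero]); rw [h] at this; linarith
    · have := h1 (by rw [h, hvi, add_zero]); rw [h] at this; linarith
  · intro h
    rcases hε.isClear _ _ C.mem C.char_pt i with h' | h' | h'
    · have := h (Or.inl h')
      rw [h']
      exact ⟨fun hv0 => by rw [this (by linarith), add_zero], fun hv1 => by linarith⟩
    · have := h (Or.inr h')
      rw [h']
      exact ⟨fun hv1 => by linarith, fun hv0 => by rw [this (by linarith), add_zero]⟩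
    · exact ⟨fun _ => by linarith, fun _ => by linarith⟩

theorem face_zero_subset (hε : K.IsClearance p ε) {v : C.Vec} (hv : ‖v‖ < ε) :
    C.face 0 ⊆ C.face v := fun u hu => by
  rw [mem_face_iff hε hv]
  rw [mem_face_zero] at hu
  exact ⟨hu.1, fun i hi _ => hu.2 i hi⟩

theorem smul_edge_mem_face (hε : K.IsClearance p ε) {v : C.Vec} (hv : ‖v‖ < ε)
    {i : Fin (K.dim C.cell)} (hi : C.Fixed i) (hvi : v i ≠ 0) {t : ℝ} (ht : 0 ≤ t) (ht' : t ≤ ε) :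
    t • C.edge i ∈ C.face v := by
  rw [mem_face_iff hε hv]
  refine ⟨((inCone_edge i).smul ht).mem_unitCube hε ?_, fun j hj hvj => ?_⟩
  · rw [norm_smul, hi.norm_edge, mul_one, Real.norm_of_nonneg ht]; exact ht'
  · have : j ≠ i := fun h => hvi (h ▸ hvj)
    rw [PiLp.smul_apply, edge_apply_of_ne this, smul_zero]

theorem single_mem_face_zero (hε : K.IsClearance p ε) {i : Fin (K.dim C.cell)} (hi : ¬ C.Fixed i)
    {t : ℝ} (ht : |t| ≤ ε) : (EuclideanSpace.single i t : C.Vec) ∈ C.face 0 := by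
  have hz : ∀ j, C.Fixed j → (EuclideanSpace.single i t : C.Vec) j = 0 := fun j hj => by
    have : j ≠ i := fun h => hi (h ▸ hj)
    simp [this]
  rw [mem_face_zero]
  refine ⟨InCone.mem_unitCube hε (fun j hj => by rw [hz j hj, mul_zero]) ?_, hz⟩
  rw [PiLp.norm_single]; exact ht

/-- `T` is an isometry, with inverse `T'`, between the smallest faces containing the points with
coordinate vectors `v` and `v'`. It fixes the base points, sends `v` to `v'` and is compatible
with the charts. -/
structure IsTransition (C C' : K.Chart p) (v : C.Vec) (v' : C'.Vec) (T : C.Vec → C'.Vec)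
    (T' : C'.Vec → C.Vec) : Prop where
  mapsTo : ∀ u ∈ C.face v, T u ∈ C'.face v'
  mapsTo_inv : ∀ u ∈ C'.face v', T' u ∈ C.face v
  left_inv : ∀ u ∈ C.face v, T' (T u) = u
  right_inv : ∀ u ∈ C'.face v', T (T' u) = u
  inner_map : ∀ u ∈ C.face v, ∀ w ∈ C.face v, inner ℝ (T u) (T w) = inner ℝ u w
  exp_map : ∀ u ∈ C.face v, C'.exp (T u) = C.exp u
  map_base : T v = v'
  base_mem : v ∈ C.face v

/-- The gluing isometry of the points `v`, `v'`, recentred at the base points. It preserves base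
points because distinct preimages of `p` in one cube are at least `ε` apart, while the image of one
base point is within `‖v‖ + ‖v'‖ < ε` of the other. -/
theorem exists_isTransition (hε : K.IsClearance p ε) {v : C.Vec} {v' : C'.Vec}
    (hv : C.InCone v) (hv' : C'.InCone v') (hvε : ‖v‖ < ε / 2) (hvε' : ‖v'‖ < ε / 2)
    (h : C.exp v = C'.exp v') : ∃ T T', C.IsTransition C' v v' T T' := by
  have hpos := hε.pos
  have hm := hv.mem_unitCube hε (by linarith)
  have hm' := hv'.mem_unitCube hε (by linarith)
  obtain ⟨f, g, H⟩ := (exists_isFaceIso hm hm' h).1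
  have hs := mem_cubeSupport_self hm
  have hz : C.pt ∈ cubeSupport (C.pt + v) :=
    hε.mem_cubeSupport C.mem C.char_pt (by rw [add_sub_cancel_left]; linarith)
  have hz' : C'.pt ∈ cubeSupport (C'.pt + v') :=
    hε.mem_cubeSupport C'.mem C'.char_pt (by rw [add_sub_cancel_left]; linarith)
  have hfz : f C.pt = C'.pt := by
    refine hε.eq_of_norm_sub_lt (H.mapsTo _ hz).1 ((H.char_map _ hz).trans C.char_pt) C'.mem
      C'.char_pt ?_
    have h1 : ‖f C.pt - (C'.pt + v')‖ = ‖v‖ := by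
      rw [← H.map_base, H.norm_map hs hz, sub_add_cancel_left, norm_neg]
    have h2 := norm_sub_le_norm_sub_add_norm_sub (f C.pt) (C'.pt + v') C'.pt
    rw [h1, add_sub_cancel_left] at h2
    linarith
  have hgz : g C'.pt = C.pt := by rw [← hfz, H.left_inv _ hz]
  refine ⟨fun u => f (C.pt + u) - C'.pt, fun u => g (C'.pt + u) - C.pt, ?_, ?_, ?_, ?_, ?_, ?_, ?_,
    hs⟩
  · intro u hu
    simpa [face] using H.mapsTo _ hu
  · intro u hu
    simpa [face] using H.mapsTo_inv _ hu
  · intro u hu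
    simp [H.left_inv _ hu]
  · intro u hu
    simp [H.right_inv _ hu]
  · intro u hu w hw
    have := H.inner_map hz hu hw
    rwa [hfz, add_sub_cancel_left, add_sub_cancel_left] at this
  · intro u hu
    simp only [exp, add_sub_cancel]
    exact H.char_map _ hu
  · simp [H.map_base]

/-! ### Transition maps preserve the Euclidean factor and the edges. -/

namespace IsTransition

variable {v : C.Vec} {v' : C'.Vec} {T : C.Vec → C'.Vec} {T' : C'.Vec → C.Vec}

theorem symm (H : C.IsTransition C' v v' T T') : C'.IsTransition C v' v T' T where
  mapsTo := H.mapsTo_inv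
  mapsTo_inv := H.mapsTo
  left_inv := H.right_inv
  right_inv := H.left_inv
  inner_map u hu w hw := by
    rw [← H.inner_map _ (H.mapsTo_inv u hu) _ (H.mapsTo_inv w hw), H.right_inv u hu,
      H.right_inv w hw]
  exp_map u hu := by rw [← H.exp_map _ (H.mapsTo_inv u hu), H.right_inv u hu]
  map_base := by rw [← H.map_base, H.left_inv _ H.base_mem]
  base_mem := by have := H.mapsTo _ H.base_mem; rwa [H.map_base] at this

theorem norm_map (H : C.IsTransition C' v v' T T') {u : C.Vec} (hu : u ∈ C.face v) :
    ‖T u‖ = ‖u‖ := by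
  have := H.inner_map u hu u hu
  rw [real_inner_self_eq_norm_sq, real_inner_self_eq_norm_sq] at this
  exact (sq_eq_sq₀ (norm_nonneg _) (norm_nonneg _)).1 this

theorem inner_map_left (H : C.IsTransition C' v v' T T') {u : C.Vec} (hu : u ∈ C.face v)
    {w : C'.Vec} (hw : w ∈ C'.face v') : inner ℝ (T u) w = inner ℝ u (T' w) := by
  rw [← H.inner_map u hu _ (H.mapsTo_inv w hw), H.right_inv w hw]

/-- Directions tangent to the open face of `p` are those that can be reversed inside the cone, and
transition maps preserve opposite pairs of vectors. -/
theorem map_face_zero (H : C.IsTransition C' v v' T T') (hε : K.IsClearance p ε) (hv : ‖v‖ < ε)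
    (hv' : ‖v'‖ < ε) {u : C.Vec} (hu : u ∈ C.face 0) : T u ∈ C'.face 0 := by
  have hsub := face_zero_subset hε hv
  have hrefl := (hε.isClear _ _ C.mem C.char_pt).reflectsAt hε.pos C.mem
  obtain ⟨y, hy, h1, h2⟩ := hrefl (C.pt + u) (by simpa [face] using hu)
  set w := y - C.pt with hw
  have hw0 : w ∈ C.face 0 := by simpa [face, hw] using hy
  rw [add_sub_cancel_left] at h2
  have e1 := H.inner_map u (hsub hu) w (hsub hw0)
  have n1 := H.norm_map (hsub hu)
  have n2 := H.norm_map (hsub hw0)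
  have hTu := H.mapsTo _ (hsub hu)
  have hTw := H.mapsTo _ (hsub hw0)
  -- Linearity of `T` is not available; the norm of this combination is computed from preserved
  -- inner products.
  have hzero : ε • T u + ‖u‖ • T w = 0 := by
    rw [← norm_eq_zero, ← sq_eq_zero_iff]
    refine le_antisymm ?_ (sq_nonneg _)
    rw [norm_add_sq_real, inner_smul_left, inner_smul_right, norm_smul, norm_smul, n1, n2, e1, h2]
    simp only [norm_norm, Real.norm_of_nonneg hε.pos.le, RCLike.conj_to_real]
    have : ‖w‖ ^ 2 ≤ ε ^ 2 := by gcongr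
    nlinarith [mul_le_mul_of_nonneg_left this (sq_nonneg ‖u‖)]
  rw [mem_face_zero]
  rw [mem_face_iff hε hv'] at hTu hTw
  refine ⟨hTu.1, fun i hi => ?_⟩
  have c1 := inCone_of_mem_unitCube hTu.1 i hi
  have c2 := inCone_of_mem_unitCube hTw.1 i hi
  have h3 : ε * T u i + ‖u‖ * T w i = 0 := by
    have := congrArg (fun x : C'.Vec => x i) hzero
    simpa using this
  have h4 : C'.sgn i * T u i = 0 := by
    have := mul_nonneg (norm_nonneg u) c2
    have h5 : ε * (C'.sgn i * T u i) + ‖u‖ * (C'.sgn i * T w i) = 0 := by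
      linear_combination C'.sgn i * h3
    have h6 : 0 ≤ ε * (C'.sgn i * T u i) := mul_nonneg hε.pos.le c1
    have h7 : ε * (C'.sgn i * T u i) = 0 := by linarith
    exact (mul_eq_zero.1 h7).resolve_left hε.pos.ne'
  exact (mul_eq_zero.1 h4).resolve_left hi.sgn_ne_zero

/-- Transition maps send vectors along edges to vectors whose coordinates that are not fixed
vanish. -/
theorem map_edge_apply_of_not_fixed (H : C.IsTransition C' v v' T T') (hε : K.IsClearance p ε)
    (hv : ‖v‖ < ε) (hv' : ‖v'‖ < ε) {i : Fin (K.dim C.cell)} (hi : C.Fixed i) (hvi : v i ≠ 0)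
    {t : ℝ} (ht : 0 ≤ t) (ht' : t ≤ ε) {k : Fin (K.dim C'.cell)} (hk : ¬ C'.Fixed k) :
    T (t • C.edge i) k = 0 := by
  have hmem := smul_edge_mem_face hε hv hi hvi ht ht'
  have hs := single_mem_face_zero hε hk (abs_of_pos hε.pos).le
  have h1 := H.inner_map_left hmem (face_zero_subset hε hv' hs)
  -- The `k`-th axis pulls back to a tangential vector, which is orthogonal to the edge `i`.
  have h2 := H.symm.map_face_zero hε hv' hv hs
  rw [mem_face_zero] at h2
  rw [EuclideanSpace.inner_single_right, inner_smul_left, real_inner_comm, inner_edge,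
    h2.2 i hi] at h1
  simpa [hε.pos.ne'] using h1

/-- If the image `D` of an edge vector had two nonzero coordinates, the two edges of `C'` concerned
would pull back to orthogonal vectors with nonnegative signed coordinates, both positive at `i`,
which is impossible. So `D` is a multiple of one edge, and norm and sign fix the multiple. -/
theorem exists_map_edge (H : C.IsTransition C' v v' T T') (hε : K.IsClearance p ε)
    (hv : ‖v‖ < ε) (hv' : ‖v'‖ < ε) {i : Fin (K.dim C.cell)} (hi : C.Fixed i) (hvi : v i ≠ 0)
    {t : ℝ} (ht : 0 < t) (ht' : t ≤ ε) :
    ∃ j, C'.Fixed j ∧ v' j ≠ 0 ∧ T (t • C.edge i) = t • C'.edge j := by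
  have hmem := smul_edge_mem_face hε hv hi hvi ht.le ht'
  set D := T (t • C.edge i) with hD
  have hDmem := H.mapsTo _ hmem
  have hDnorm : ‖D‖ = t := by
    rw [hD, H.norm_map hmem, norm_smul, hi.norm_edge, mul_one, Real.norm_of_nonneg ht.le]
  have hfree : ∀ k, ¬ C'.Fixed k → D k = 0 := fun k hk =>
    H.map_edge_apply_of_not_fixed hε hv hv' hi hvi ht.le ht' hk
  have hDface := (mem_face_iff hε hv').1 hDmem
  have hne : ∀ j, C'.Fixed j → D j ≠ 0 → v' j ≠ 0 := fun j hj hDj h => hDj (hDface.2 j hj h)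
  have hpull : ∀ j, C'.Fixed j → D j ≠ 0 → T' (t • C'.edge j) ∈ C.face v ∧
      T' (t • C'.edge j) i ≠ 0 := by
    intro j hj hDj
    have hm := smul_edge_mem_face hε hv' hj (hne j hj hDj) ht.le ht'
    refine ⟨H.mapsTo_inv _ hm, fun h0 => ?_⟩
    have := H.inner_map_left hmem hm
    rw [← hD, inner_smul_right, inner_smul_left, real_inner_comm (T' _), inner_edge, inner_edge,
      h0] at this
    simp [ht.ne', hDj, hj.sgn_ne_zero] at this
  have huniq : ∀ j j', D j ≠ 0 → D j' ≠ 0 → j = j' := by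
    intro j j' hDj hDj'
    by_contra hjj
    have hj : C'.Fixed j := by by_contra h; exact hDj (hfree j h)
    have hj' : C'.Fixed j' := by by_contra h; exact hDj' (hfree j' h)
    have hm := smul_edge_mem_face hε hv' hj (hne j hj hDj) ht.le ht'
    have hm' := smul_edge_mem_face hε hv' hj' (hne j' hj' hDj') ht.le ht'
    obtain ⟨h1, h1'⟩ := hpull j hj hDj
    obtain ⟨h2, h2'⟩ := hpull j' hj' hDj'
    have horth := H.symm.inner_map _ hm _ hm'
    rw [inner_smul_left, inner_smul_right, inner_edge, edge_apply_of_ne (Ne.symm hjj)] at horth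
    simp only [mul_zero] at horth
    have hc1 := inCone_of_mem_unitCube ((mem_face_iff hε hv).1 h1).1
    have hc2 := inCone_of_mem_unitCube ((mem_face_iff hε hv).1 h2).1
    rw [PiLp.inner_apply] at horth
    have hterm : ∀ k, 0 ≤ inner ℝ (T' (t • C'.edge j) k) (T' (t • C'.edge j') k) := by
      intro k
      by_cases hk : C.Fixed k
      · have := mul_nonneg (hc1 k hk) (hc2 k hk)
        have e : C.sgn k * T' (t • C'.edge j) k * (C.sgn k * T' (t • C'.edge j') k) =
          (C.sgn k * C.sgn k) * (T' (t • C'.edge j') k * T' (t • C'.edge j) k) := by ring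
        rw [e, hk.sgn_mul_self, one_mul] at this
        exact this
      · rw [H.symm.map_edge_apply_of_not_fixed hε hv' hv hj (hne j hj hDj) ht.le ht' hk,
          inner_zero_left]
    have := (Finset.sum_eq_zero_iff_of_nonneg fun k _ => hterm k).1 horth i (Finset.mem_univ i)
    simp [h1', h2'] at this
  obtain ⟨j, hDj⟩ : ∃ j, D j ≠ 0 := by
    by_contra! h
    have : D = 0 := by ext j; simpa using h j
    rw [this, norm_zero] at hDnorm
    exact ht.ne hDnorm
  have hj : C'.Fixed j := by by_contra h; exact hDj (hfree j h)
  have hDeq : D = EuclideanSpace.single j (D j) := by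
    ext k
    by_cases hk : k = j
    · subst hk; simp
    · have : D k = 0 := by by_contra h; exact hk (huniq k j h hDj)
      simp [hk, this]
  have hcone := inCone_of_mem_unitCube hDface.1 j hj
  have habs : C'.sgn j * D j = t := by
    rw [hDeq, PiLp.norm_single, Real.norm_eq_abs] at hDnorm
    rw [← abs_of_nonneg hcone, abs_mul, hj.abs_sgn, one_mul, hDnorm]
  have hval : D j = t * C'.sgn j := by
    rw [← habs]
    linear_combination (-D j) * hj.sgn_mul_self
  refine ⟨j, hj, hne j hj hDj, ?_⟩
  rw [hDeq, hval]
  ext k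
  by_cases hk : k = j
  · subst hk; simp [edge]
  · simp [edge, hk]

end IsTransition

/-- The point at distance `ε / 4` from the base point on the edge `i`. -/
noncomputable def label (C : K.Chart p) (ε : ℝ) (i : Fin (K.dim C.cell)) : X :=
  C.exp ((ε / 4) • C.edge i)

/-- A label thus names an edge independently of the chart, and nonzero edge coordinates depend only
on the point and the label. -/
theorem exists_label_eq (hε : K.IsClearance p ε) {v : C.Vec} {v' : C'.Vec}
    (hv : C.InCone v) (hv' : C'.InCone v') (hvε : ‖v‖ < ε / 2) (hvε' : ‖v'‖ < ε / 2)
    (h : C.exp v = C'.exp v') {i : Fin (K.dim C.cell)} (hi : C.Fixed i) (hvi : v i ≠ 0) :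
    ∃ j, C'.Fixed j ∧ C'.label ε j = C.label ε i ∧ C'.sgn j * v' j = C.sgn i * v i := by
  have hpos := hε.pos
  obtain ⟨T, T', H⟩ := exists_isTransition hε hv hv' hvε hvε' h
  obtain ⟨j, hj, -, hT⟩ := H.exists_map_edge hε (by linarith) (by linarith) hi hvi
    (t := ε / 4) (by linarith) (by linarith)
  have hmem := smul_edge_mem_face hε (v := v) (by linarith) hi hvi (t := ε / 4) (by linarith)
    (by linarith)
  refine ⟨j, hj, ?_, ?_⟩
  · rw [label, label, ← H.exp_map _ hmem, hT]
  · have := H.inner_map _ H.base_mem _ hmem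
    rw [H.map_base, hT, inner_smul_right, inner_smul_right, inner_edge, inner_edge] at this
    exact mul_left_cancel₀ (by linarith) this

theorem norm_eq_of_exp_eq (hε : K.IsClearance p ε) {v : C.Vec} {v' : C'.Vec}
    (hv : C.InCone v) (hv' : C'.InCone v') (hvε : ‖v‖ < ε / 2) (hvε' : ‖v'‖ < ε / 2)
    (h : C.exp v = C'.exp v') : ‖v'‖ = ‖v‖ := by
  obtain ⟨T, T', H⟩ := exists_isTransition hε hv hv' hvε hvε' h
  rw [← H.map_base, H.norm_map H.base_mem]

theorem norm_smul_edge {i : Fin (K.dim C.cell)} (hi : C.Fixed i) {t : ℝ} (ht : 0 ≤ t) :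
    ‖t • C.edge i‖ = t := by
  rw [norm_smul, hi.norm_edge, mul_one, Real.norm_of_nonneg ht]

theorem exp_smul_edge_eq (hε : K.IsClearance p ε) {i : Fin (K.dim C.cell)}
    {j : Fin (K.dim C'.cell)} (hi : C.Fixed i) (hj : C'.Fixed j)
    (h : C.label ε i = C'.label ε j) {t : ℝ} (ht : 0 ≤ t) (ht' : t ≤ ε) :
    C.exp (t • C.edge i) = C'.exp (t • C'.edge j) := by
  have hpos := hε.pos
  have hn := norm_smul_edge hi (t := ε / 4) (by linarith)
  have hn' := norm_smul_edge hj (t := ε / 4) (by linarith)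
  obtain ⟨T, T', H⟩ := exists_isTransition hε ((inCone_edge i).smul (t := ε / 4) (by linarith))
    ((inCone_edge j).smul (t := ε / 4) (by linarith)) (by linarith) (by linarith) h
  have hmem : t • C.edge i ∈ C.face ((ε / 4) • C.edge i) := by
    refine smul_edge_mem_face hε (by linarith) hi ?_ ht ht'
    rw [PiLp.smul_apply, edge_apply_self, smul_eq_mul]
    exact mul_ne_zero (by linarith) hi.sgn_ne_zero
  rw [← H.exp_map _ hmem]
  congr 1
  have h1 := H.inner_map _ hmem _ H.base_mem
  have h2 := H.norm_map hmem
  rw [H.map_base, inner_smul_right, inner_smul_right, inner_smul_left, inner_edge, inner_edge,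
    edge_apply_self, hi.sgn_mul_self, mul_one] at h1
  have h3 : inner ℝ (T (t • C.edge i)) (C'.edge j) = t := by
    rw [inner_edge]
    exact mul_left_cancel₀ (show ε / 4 ≠ 0 by linarith) (by simpa using h1)
  rw [norm_smul_edge hi ht] at h2
  -- Equality case of Cauchy-Schwarz: both vectors have norm `t`, and their inner product is `t ^
  -- 2`.
  rw [← sub_eq_zero, ← norm_eq_zero, ← sq_eq_zero_iff, norm_sub_sq_real, inner_smul_right, h2, h3,
    norm_smul_edge hj ht]
  ring

end Chart

/-- Local form of `IsClearance.dist_map_le` in charts. -/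
theorem IsClearance.dist_map_exp_le (hε : K.IsClearance p ε) {M : Type*} [PseudoMetricSpace M]
    {ρ : ℝ} (hρ : ρ ≤ ε) (Ψ : X → M)
    (hΨ : ∀ (C : K.Chart p) (v w : C.Vec), C.InCone v → C.InCone w → ‖v‖ < ρ → ‖w‖ < ρ →
      dist (Ψ (C.exp v)) (Ψ (C.exp w)) ≤ ‖v - w‖)
    {q r : X} (h : dist p q + dist q r < ρ) : dist (Ψ q) (Ψ r) ≤ dist q r := by
  refine hε.dist_map_le hρ Ψ (fun a z hz hzp x hx y hy hxz hyz => ?_) h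
  let C : K.Chart p := ⟨a, z, hz, hzp⟩
  have hC : ∀ x, C.pt + (x - z) = x := fun x => add_sub_cancel _ _
  have := hΨ C (x - z) (y - z) (Chart.inCone_of_mem_unitCube (by rw [hC]; exact hx))
    (Chart.inCone_of_mem_unitCube (by rw [hC]; exact hy)) hxz hyz
  rwa [Chart.exp, Chart.exp, hC, hC, sub_sub_sub_cancel_right] at this

end CubeComplex

/-! ### Uniqueness of geodesics -/

section Geodesics

variable {X : Type u} [MetricSpace X]

theorem isGeodesicOn_of_dist_le {γ : ℝ → X} {l : ℝ}
    (h : ∀ s ∈ Set.Icc 0 l, ∀ t ∈ Set.Icc 0 l, dist (γ s) (γ t) ≤ |s - t|)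
    (hl : l ≤ dist (γ 0) (γ l)) : IsGeodesicOn γ l := by
  have key : ∀ s ∈ Set.Icc 0 l, ∀ t ∈ Set.Icc 0 l, s ≤ t → dist (γ s) (γ t) = |s - t| := by
    intro s hs t ht hst
    refine le_antisymm (h s hs t ht) ?_
    have hl0 : 0 ≤ l := hs.1.trans hs.2
    have h1 := h 0 ⟨le_rfl, hl0⟩ s hs
    have h2 := h t ht l ⟨hl0, le_rfl⟩
    have h3 := dist_triangle4 (γ 0) (γ s) (γ t) (γ l)
    rw [abs_sub_comm, sub_zero, abs_of_nonneg hs.1] at h1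
    rw [abs_sub_comm, abs_of_nonneg (sub_nonneg.2 ht.2)] at h2
    rw [abs_sub_comm, abs_of_nonneg (sub_nonneg.2 hst)]
    linarith
  intro s hs t ht
  rcases le_total s t with hst | hst
  · exact key s hs t ht hst
  · rw [dist_comm, abs_sub_comm]; exact key t ht s hs hst

/-- Comparison with the degenerate triangle `x, y, y`, realized on a line in the plane, where both
comparison points are `e t`. -/
theorem IsCAT0.geodesic_unique (hX : IsCAT0 X) {x y : X} {c c' : ℝ → X}
    (hc : IsGeodesicFromTo c x y) (hc' : IsGeodesicFromTo c' x y) {t : ℝ}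
    (ht : t ∈ Set.Icc 0 (dist x y)) : c t = c' t := by
  let e : ℝ → EuclideanSpace ℝ (Fin 2) := fun r => EuclideanSpace.single 0 r
  have he : ∀ r, 0 ≤ r → dist (e 0) (e r) = r := fun r hr => by
    have h0 : e 0 = 0 := by ext i; simp [e]
    rw [h0, dist_zero_left, PiLp.norm_single, Real.norm_of_nonneg hr]
  have hseg : e t ∈ segment ℝ (e 0) (e (dist x y)) := by
    rcases eq_or_lt_of_le (dist_nonneg (x := x) (y := y)) with h0 | h0
    · have : t = 0 := le_antisymm (by rw [h0]; exact ht.2) ht.1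
      rw [this]; exact left_mem_segment _ _ _
    · refine ⟨1 - t / dist x y, t / dist x y, ?_, div_nonneg ht.1 h0.le, by ring, ?_⟩
      · rw [sub_nonneg, div_le_one h0]; exact ht.2
      · ext i
        by_cases hi : i = 0
        · subst hi; simp [e, div_mul_cancel₀ _ h0.ne']
        · simp [e, hi]
  have := hX.comparison x y y c c' hc hc' (e 0) (e (dist x y)) (e (dist x y))
    (he _ dist_nonneg) (he _ dist_nonneg) (by simp) t ht t ht (e t) hseg (e t) hseg
    (he t ht.1) (he t ht.1)
  rw [dist_self] at this
  exact dist_le_zero.1 this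

end Geodesics

namespace CubeComplex

variable {X : Type u} [MetricSpace X] {K : CubeComplex.{u, v} X} {p : X} {ε : ℝ}

namespace Chart

variable {C C' : K.Chart p}

theorem segment_mem_unitCube {v w : C.Vec} (hv : C.pt + v ∈ unitCube _)
    (hw : C.pt + w ∈ unitCube _) {θ : ℝ} (h0 : 0 ≤ θ) (h1 : θ ≤ 1) :
    C.pt + (v + θ • (w - v)) ∈ unitCube _ := by
  intro i
  have a := hv i
  have b := hw i
  simp only [PiLp.add_apply, PiLp.smul_apply, PiLp.sub_apply, smul_eq_mul] at a b ⊢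
  have e : C.pt i + (v i + θ * (w i - v i)) = (1 - θ) * (C.pt i + v i) + θ * (C.pt i + w i) := by
    ring
  rw [e]
  constructor <;> nlinarith [mul_nonneg h0 b.1, mul_nonneg h0 (sub_nonneg.2 b.2),
    mul_nonneg (sub_nonneg.2 h1) a.1, mul_nonneg (sub_nonneg.2 h1) (sub_nonneg.2 a.2)]

theorem isGeodesicFromTo_segment {v w : C.Vec} (hv : C.pt + v ∈ unitCube _)
    (hw : C.pt + w ∈ unitCube _) (h : ‖v - w‖ ≤ dist (C.exp v) (C.exp w)) :
    IsGeodesicFromTo (fun s => C.exp (v + (s / ‖v - w‖) • (w - v))) (C.exp v) (C.exp w) := by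
  have hd : dist (C.exp v) (C.exp w) = ‖v - w‖ := le_antisymm (dist_exp_le hv hw) h
  have hend : C.exp (v + (‖v - w‖ / ‖v - w‖) • (w - v)) = C.exp w := by
    rcases eq_or_ne (‖v - w‖) 0 with h0 | h0
    · rw [norm_eq_zero, sub_eq_zero] at h0; simp [h0]
    · rw [div_self h0, one_smul, add_sub_cancel]
  refine ⟨by simp, by rw [hd]; exact hend, ?_⟩
  rw [hd]
  apply isGeodesicOn_of_dist_le
  · intro s hs t ht
    rcases eq_or_lt_of_le (norm_nonneg (v - w)) with h0 | h0
    · rw [← h0]; simp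
    · refine (dist_exp_le
        (segment_mem_unitCube hv hw (div_nonneg hs.1 h0.le) ((div_le_one h0).2 hs.2))
        (segment_mem_unitCube hv hw (div_nonneg ht.1 h0.le) ((div_le_one h0).2 ht.2))).trans ?_
      rw [add_sub_add_left_eq_sub, ← sub_smul, norm_smul, norm_sub_rev w v, ← sub_div,
        Real.norm_eq_abs, abs_div, abs_norm, div_mul_cancel₀ _ h0.ne']
  · simp only [zero_div, zero_smul, add_zero]
    rw [hend, hd]

/-- Segments whose Euclidean length is the distance of their end points are geodesics, so uniqueness
identifies them across charts. This is how the CAT(0) condition acts on the combinatorics. -/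
theorem exp_segment_eq (hX : IsCAT0 X) {v w : C.Vec} {v' w' : C'.Vec}
    (hv : C.pt + v ∈ unitCube _) (hw : C.pt + w ∈ unitCube _)
    (hv' : C'.pt + v' ∈ unitCube _) (hw' : C'.pt + w' ∈ unitCube _)
    (hvv : C.exp v = C'.exp v') (hww : C.exp w = C'.exp w')
    (h : ‖v - w‖ ≤ dist (C.exp v) (C.exp w)) (h' : ‖v' - w'‖ ≤ dist (C.exp v) (C.exp w))
    {θ : ℝ} (h0 : 0 ≤ θ) (h1 : θ ≤ 1) :
    C.exp (v + θ • (w - v)) = C'.exp (v' + θ • (w' - v')) := by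
  have hd : dist (C.exp v) (C.exp w) = ‖v - w‖ := le_antisymm (dist_exp_le hv hw) h
  have hd' : dist (C.exp v) (C.exp w) = ‖v' - w'‖ :=
    le_antisymm (by rw [hvv, hww]; exact dist_exp_le hv' hw') h'
  have g := isGeodesicFromTo_segment hv hw h
  have g' := isGeodesicFromTo_segment hv' hw' (by rw [← hvv, ← hww]; exact h')
  rw [← hvv, ← hww] at g'
  have := hX.geodesic_unique g g' (t := θ * dist (C.exp v) (C.exp w))
    ⟨mul_nonneg h0 dist_nonneg, mul_le_of_le_one_left dist_nonneg h1⟩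
  simp only [← hd, ← hd'] at this
  rcases eq_or_ne (dist (C.exp v) (C.exp w)) 0 with hz | hz
  · rw [hz, eq_comm, norm_eq_zero, sub_eq_zero] at hd hd'
    simp [← hd, ← hd', hvv]
  · rwa [mul_div_cancel_right₀ _ hz] at this

/-- Equal vanishing patterns put both points in the same open face, where `inj` applies. -/
theorem eq_of_exp_eq (hε : K.IsClearance p ε) {v w : C.Vec} (hv : C.InCone v) (hw : C.InCone w)
    (hvε : ‖v‖ < ε) (hwε : ‖w‖ < ε) (h0 : ∀ i, C.Fixed i → (v i = 0 ↔ w i = 0))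
    (h : C.exp v = C.exp w) : v = w := by
  have hvm := hv.mem_unitCube hε hvε.le
  have hwm := hw.mem_unitCube hε hwε.le
  have h1 : w ∈ C.face v := (mem_face_iff hε hvε).2 ⟨hwm, fun i hi => (h0 i hi).1⟩
  have h2 : v ∈ C.face w := (mem_face_iff hε hwε).2 ⟨hvm, fun i hi => (h0 i hi).2⟩
  exact add_left_cancel (K.inj _ _ hvm _ hwm (sameOpenFace_of_mem_cubeSupport h1 h2) h)

/-! ### Distinct edges of a chart have distinct labels -/

/-- The lengths whose infimum is the distance to the union of the edges at `p`. -/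
def edgeDistances (C : K.Chart p) (v : C.Vec) : Set ℝ :=
  {r | r = ‖v‖ ∨ ∃ i, C.Fixed i ∧ r = ‖v - EuclideanSpace.single i (v i)‖}

theorem norm_sub_single_sq (v : C.Vec) (i : Fin (K.dim C.cell)) :
    ‖v - EuclideanSpace.single i (v i)‖ ^ 2 = ‖v‖ ^ 2 - v i ^ 2 := by
  rw [norm_sub_sq_real, EuclideanSpace.inner_single_right, PiLp.norm_single, Real.norm_eq_abs,
    sq_abs]
  simp
  ring

/-- Makes `distToEdges` computable in any single chart. -/
theorem mem_edgeDistances_of_exp_eq (hε : K.IsClearance p ε) {v : C.Vec} {v' : C'.Vec}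
    (hv : C.InCone v) (hv' : C'.InCone v') (hvε : ‖v‖ < ε / 2) (hvε' : ‖v'‖ < ε / 2)
    (h : C.exp v = C'.exp v') {r : ℝ} (hr : r ∈ C.edgeDistances v) :
    r ∈ C'.edgeDistances v' := by
  have hn := norm_eq_of_exp_eq hε hv hv' hvε hvε' h
  rcases hr with rfl | ⟨i, hi, rfl⟩
  · exact Or.inl hn.symm
  · by_cases hvi : v i = 0
    -- An edge of `C` with `v i = 0` need not occur in `C'`; its contribution is `‖v‖`, which
    -- belongs to the set for this reason.
    · left
      have h0 : (EuclideanSpace.single i (0 : ℝ) : C.Vec) = 0 := by ext k; simp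
      rw [hvi, hn, h0, sub_zero]
    · obtain ⟨j, hj, -, hjv⟩ := exists_label_eq hε hv hv' hvε hvε' h hi hvi
      refine Or.inr ⟨j, hj, ?_⟩
      rw [← sq_eq_sq₀ (norm_nonneg _) (norm_nonneg _), norm_sub_single_sq, norm_sub_single_sq, hn]
      have e1 : v i ^ 2 = (C.sgn i * v i) ^ 2 := by
        linear_combination (-(v i) ^ 2) * hi.sgn_mul_self
      have e2 : v' j ^ 2 = (C'.sgn j * v' j) ^ 2 := by
        linear_combination (-(v' j) ^ 2) * hj.sgn_mul_self
      rw [e1, e2, hjv]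

end Chart

/-- The distance from `q` to the union of the edges at `p`, measured in a chart at `p`. -/
noncomputable def distToEdges (K : CubeComplex.{u, v} X) (p : X) (ε : ℝ) (q : X) : ℝ :=
  sInf {r | ∃ (C : K.Chart p) (v : C.Vec), C.InCone v ∧ ‖v‖ < ε / 2 ∧ C.exp v = q ∧
    r ∈ C.edgeDistances v}

namespace Chart

variable {C C' : K.Chart p}

theorem distToEdges_exp (hε : K.IsClearance p ε) {v : C.Vec}
    (hv : C.InCone v) (hvε : ‖v‖ < ε / 2) :
    K.distToEdges p ε (C.exp v) = sInf (C.edgeDistances v) := by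
  unfold distToEdges
  congr 1
  ext r
  constructor
  · rintro ⟨C', v', h1, h2, h3, h4⟩
    exact mem_edgeDistances_of_exp_eq hε h1 hv h2 hvε h3 h4
  · intro h
    exact ⟨C, v, hv, hvε, rfl, h⟩

theorem edgeDistances_nonempty (v : C.Vec) : (C.edgeDistances v).Nonempty := ⟨_, Or.inl rfl⟩

theorem edgeDistances_bddBelow (v : C.Vec) : BddBelow (C.edgeDistances v) :=
  ⟨0, by rintro r (rfl | ⟨i, -, rfl⟩) <;> exact norm_nonneg _⟩

/-- Deleting one coordinate is an orthogonal projection, so every member of the set varies in a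
`1`-Lipschitz way. -/
theorem sInf_edgeDistances_le (v w : C.Vec) :
    sInf (C.edgeDistances w) ≤ sInf (C.edgeDistances v) + ‖v - w‖ := by
  rw [← sub_le_iff_le_add]
  refine le_csInf (edgeDistances_nonempty v) ?_
  rintro r (rfl | ⟨i, hi, rfl⟩)
  · rw [sub_le_iff_le_add]
    refine (csInf_le (edgeDistances_bddBelow w) (Or.inl rfl)).trans ?_
    have := norm_sub_norm_le w v
    rw [norm_sub_rev w v] at this
    linarith
  · rw [sub_le_iff_le_add]
    refine (csInf_le (edgeDistances_bddBelow w) (Or.inr ⟨i, hi, rfl⟩)).trans ?_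
    have h1 := norm_le_norm_add_norm_sub' (w - EuclideanSpace.single i (w i))
      (v - EuclideanSpace.single i (v i))
    have h2 : ‖w - EuclideanSpace.single i (w i) - (v - EuclideanSpace.single i (v i))‖ ≤
        ‖v - w‖ := by
      have e : w - EuclideanSpace.single i (w i) - (v - EuclideanSpace.single i (v i)) =
          (w - v) - EuclideanSpace.single i ((w - v) i) := by
        ext k
        by_cases hk : k = i
        · subst hk; simp
        · simp [hk]
      rw [e, norm_sub_rev v w]
      refine (sq_le_sq₀ (norm_nonneg _) (norm_nonneg _)).1 ?_
      rw [norm_sub_single_sq]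
      linarith [sq_nonneg ((w - v) i)]
    linarith

theorem dist_distToEdges_le (hε : K.IsClearance p ε) {q r : X} (h : dist p q + dist q r < ε / 2) :
    dist (K.distToEdges p ε q) (K.distToEdges p ε r) ≤ dist q r := by
  refine hε.dist_map_exp_le (by linarith [hε.pos]) _ (fun C v w hv hw hvε hwε => ?_) h
  rw [distToEdges_exp hε hv hvε, distToEdges_exp hε hw hwε, Real.dist_eq, abs_le]
  have h1 := sInf_edgeDistances_le v w
  have h2 := sInf_edgeDistances_le w v
  rw [norm_sub_rev] at h2
  constructor <;> linarith

/-- If edges `i ≠ j` coincided in `X`, the sides of the square on them from the corner `u` to `τ •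
edge i` and to `τ • edge j` would be geodesics with the same end points. Uniqueness identifies their
midpoints, which lie in one open face and differ there. -/
theorem label_injective (hX : IsCAT0 X) (hε : K.IsClearance p ε) {i j : Fin (K.dim C.cell)}
    (hi : C.Fixed i) (hj : C.Fixed j) (h : C.label ε i = C.label ε j) : i = j := by
  by_contra hij
  have hpos := hε.pos
  set τ := ε / 16 with hτ
  have hτ0 : 0 < τ := by linarith
  set u : C.Vec := τ • C.edge i + τ • C.edge j with hu
  have hei : ∀ t : ℝ, 0 ≤ t → C.InCone (t • C.edge i) := fun t ht => (inCone_edge i).smul ht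
  have hej : ∀ t : ℝ, 0 ≤ t → C.InCone (t • C.edge j) := fun t ht => (inCone_edge j).smul ht
  have huc : C.InCone u := (hei τ hτ0.le).add (hej τ hτ0.le)
  have hni := norm_smul_edge hi hτ0.le
  have hnj := norm_smul_edge hj hτ0.le
  have hun : ‖u‖ ≤ 2 * τ := (norm_add_le _ _).trans (by linarith)
  have hmem : ∀ {x : C.Vec}, C.InCone x → ‖x‖ ≤ 2 * τ → C.pt + x ∈ unitCube _ :=
    fun hx hn => hx.mem_unitCube hε (by linarith)
  have hexp := exp_smul_edge_eq hε hi hj h hτ0.le (by linarith)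
  have hui : u i = τ * C.sgn i := by
    simp [hu, edge_apply_self, edge_apply_of_ne hij]
  have huj : u j = τ * C.sgn j := by
    simp [hu, edge_apply_self, edge_apply_of_ne (Ne.symm hij)]
  -- The lower bound comes from `distToEdges`, which is `1`-Lipschitz, vanishes on the edge and is
  -- at least `τ` at `u`. The development cannot serve here, since its isometry rests on this lemma.
  have hd : dist (C.exp u) (C.exp (τ • C.edge i)) = τ := by
    refine le_antisymm ?_ ?_
    · refine (dist_exp_le (hmem huc hun) (hmem (hei τ hτ0.le) (by linarith))).trans ?_
      rw [hu, add_sub_cancel_left, hnj]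
    · have hpu : dist p (C.exp u) ≤ 2 * τ := by
        have := dist_exp_le (C := C) (v := 0) (w := u) (by simpa using C.mem) (hmem huc hun)
        rw [exp_zero, zero_sub, norm_neg] at this
        linarith
      have hdu : dist (C.exp u) (C.exp (τ • C.edge i)) ≤ τ := by
        refine (dist_exp_le (hmem huc hun) (hmem (hei τ hτ0.le) (by linarith))).trans ?_
        rw [hu, add_sub_cancel_left, hnj]
      have hlip := dist_distToEdges_le hε (q := C.exp u) (r := C.exp (τ • C.edge i)) (by linarith)
      rw [distToEdges_exp hε huc (by linarith), distToEdges_exp hε (hei τ hτ0.le) (by linarith),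
        Real.dist_eq] at hlip
      have h1 : sInf (C.edgeDistances (τ • C.edge i)) ≤ 0 := by
        refine csInf_le (edgeDistances_bddBelow _) (Or.inr ⟨i, hi, ?_⟩)
        rw [eq_comm, norm_eq_zero, sub_eq_zero]
        ext k
        by_cases hk : k = i
        · subst hk; simp
        · simp [edge, hk]
      have h2 : τ ≤ sInf (C.edgeDistances u) := by
        refine le_csInf (edgeDistances_nonempty u) ?_
        have ai : |u i| = τ := by rw [hui, abs_mul, hi.abs_sgn, mul_one, abs_of_pos hτ0]
        have aj : |u j| = τ := by rw [huj, abs_mul, hj.abs_sgn, mul_one, abs_of_pos hτ0]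
        rintro r (rfl | ⟨k, hk, rfl⟩)
        · rw [← ai]; exact abs_coord_le_norm u i
        · by_cases hki : i = k
          · have := abs_coord_le_norm (u - EuclideanSpace.single k (u k)) j
            have hjk : j ≠ k := fun h => hij (hki.trans h.symm)
            simpa [hjk, aj] using this
          · have := abs_coord_le_norm (u - EuclideanSpace.single k (u k)) i
            simpa [hki, ai] using this
      have := (abs_le.1 hlip).2
      linarith
  have hseg := exp_segment_eq hX (C := C) (C' := C) (v := u) (w := τ • C.edge i) (v' := u)
    (w' := τ • C.edge j) (hmem huc hun) (hmem (hei τ hτ0.le) (by linarith)) (hmem huc hun)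
    (hmem (hej τ hτ0.le) (by linarith)) rfl hexp
    (by rw [hd, hu, add_sub_cancel_left, hnj]) (by rw [hd, hu, add_sub_cancel_right, hni])
    (θ := 1 / 2) (by norm_num) (by norm_num)
  have e1 : u + (1 / 2 : ℝ) • (τ • C.edge i - u) = τ • C.edge i + (τ / 2) • C.edge j := by
    rw [hu]; module
  have e2 : u + (1 / 2 : ℝ) • (τ • C.edge j - u) = (τ / 2) • C.edge i + τ • C.edge j := by
    rw [hu]; module
  rw [e1, e2] at hseg
  have hni2 := norm_smul_edge hi (t := τ / 2) (by linarith)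
  have hnj2 := norm_smul_edge hj (t := τ / 2) (by linarith)
  have := eq_of_exp_eq hε ((hei τ hτ0.le).add (hej (τ / 2) (by linarith)))
    ((hei (τ / 2) (by linarith)).add (hej τ hτ0.le))
    ((norm_add_le _ _).trans_lt (by linarith)) ((norm_add_le _ _).trans_lt (by linarith))
    (fun k _ => by
      by_cases hki : k = i
      · subst hki
        simp [edge_apply_of_ne hij, hτ0.ne']
      · by_cases hkj : k = j
        · subst hkj
          simp [edge_apply_of_ne hki, hτ0.ne']
        · simp [edge_apply_of_ne hki, edge_apply_of_ne hkj]) hseg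
  have := congrArg (fun x : C.Vec => x i) this
  simp only [PiLp.add_apply, PiLp.smul_apply, edge_apply_self, edge_apply_of_ne hij, smul_eq_mul,
    mul_zero, add_zero] at this
  have hs := mul_right_cancel₀ hi.sgn_ne_zero this
  linarith

end Chart

end CubeComplex

/-! ### Developing the cubes at `p` into a Hilbert space -/

namespace CubeComplex

variable {X : Type u} [MetricSpace X] {K : CubeComplex.{u, v} X} {p : X} {ε : ℝ}

namespace Chart

variable {R C C' : K.Chart p}

noncomputable instance (C : K.Chart p) : DecidablePred C.Fixed := Classical.decPred _

theorem norm_sq_eq_sum_not_fixed {u : C.Vec} (hu : ∀ i, C.Fixed i → u i = 0) :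
    ‖u‖ ^ 2 = ∑ k : {k // ¬ C.Fixed k}, u k ^ 2 := by
  rw [EuclideanSpace.real_norm_sq_eq, ← Fintype.sum_subtype_add_sum_subtype C.Fixed,
    Finset.sum_eq_zero fun i _ => by rw [hu i.1 i.2]; norm_num, zero_add]

/-- `f` is an orthonormal basis of the tangent space of the open face of `C` that contains the base
point, and it corresponds to the standard basis in the chart `R`. -/
structure IsFrame (R C : K.Chart p) (ε : ℝ) (f : {k // ¬ R.Fixed k} → C.Vec) : Prop where
  apply_fixed : ∀ k i, C.Fixed i → f k i = 0
  orthonormal : Orthonormal ℝ f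
  exp_eq : ∀ k, C.exp ((ε / 4) • f k) = R.exp ((ε / 4) • EuclideanSpace.single k.1 1)
  parseval : ∀ u : C.Vec, (∀ i, C.Fixed i → u i = 0) → ∑ k, inner ℝ (f k) u ^ 2 = ‖u‖ ^ 2

theorem inCone_of_apply_fixed {u : C.Vec} (hu : ∀ i, C.Fixed i → u i = 0) : C.InCone u :=
  fun i hi => by rw [hu i hi, mul_zero]

theorem mem_face_zero_of_norm_le (hε : K.IsClearance p ε) {u : C.Vec}
    (hu : ∀ i, C.Fixed i → u i = 0) (h : ‖u‖ ≤ ε) : u ∈ C.face 0 :=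
  mem_face_zero.2 ⟨(inCone_of_apply_fixed hu).mem_unitCube hε h, hu⟩

theorem exists_isTransition_zero (hε : K.IsClearance p ε) (C C' : K.Chart p) :
    ∃ T T', C.IsTransition C' 0 0 T T' :=
  exists_isTransition hε inCone_zero inCone_zero (by rw [norm_zero]; linarith [hε.pos])
    (by rw [norm_zero]; linarith [hε.pos]) (by rw [exp_zero, exp_zero])

theorem exists_pos_smul_norm_lt (u : C.Vec) {η : ℝ} (hη : 0 < η) : ∃ t : ℝ, 0 < t ∧ ‖t • u‖ < η := by
  refine ⟨η / (1 + ‖u‖), by positivity, ?_⟩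
  rw [norm_smul, Real.norm_of_nonneg (by positivity), div_mul_eq_mul_div, div_lt_iff₀ (by positivity)]
  nlinarith [norm_nonneg u]

/-- The coordinate axes of the open face in `R`, carried to `C` by the transition map of this face;
the factor `ε / 4` brings them into its domain and is divided out again. -/
theorem exists_isFrame (hε : K.IsClearance p ε) (R C : K.Chart p) : ∃ f, R.IsFrame C ε f := by
  have hpos := hε.pos
  have hpos4 : 0 < ε / 4 := by linarith
  obtain ⟨T, T', H⟩ := exists_isTransition_zero hε R C
  have hmem : ∀ k : {k // ¬ R.Fixed k},
      (ε / 4) • (EuclideanSpace.single k.1 1 : R.Vec) ∈ R.face 0 := by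
    intro k
    have : (ε / 4) • (EuclideanSpace.single k.1 1 : R.Vec) = EuclideanSpace.single k.1 (ε / 4) := by
      ext j
      by_cases hj : j = k.1
      · subst hj; simp
      · simp [hj]
    rw [this]
    exact single_mem_face_zero hε k.2 (by rw [abs_of_pos hpos4]; linarith)
  have hTmem := fun k => H.mapsTo _ (hmem k)
  set f : {k // ¬ R.Fixed k} → C.Vec :=
    fun k => (ε / 4)⁻¹ • T ((ε / 4) • EuclideanSpace.single k.1 1) with hf
  have hsf : ∀ k, (ε / 4) • f k = T ((ε / 4) • EuclideanSpace.single k.1 1) := fun k => by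
    rw [hf]; exact smul_inv_smul₀ hpos4.ne' _
  have hinner : ∀ k, ∀ u ∈ R.face 0, inner ℝ (f k) (T u) = u k.1 := by
    intro k u hu
    rw [hf]
    simp only
    rw [inner_smul_left, H.inner_map _ (hmem k) u hu, inner_smul_left,
      EuclideanSpace.inner_single_left]
    simp
    field_simp
  refine ⟨f, ?_, ?_, ?_, ?_⟩
  · intro k i hi
    have := (mem_face_zero.1 (hTmem k)).2 i hi
    rw [hf]
    simp [this]
  · rw [orthonormal_iff_ite]
    intro k l
    have h1 := hinner k _ (hmem l)
    rw [← hsf l, inner_smul_right] at h1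
    have : inner ℝ (f k) (f l) = (EuclideanSpace.single l.1 1 : R.Vec) k.1 := by
      rw [PiLp.smul_apply, smul_eq_mul] at h1
      exact mul_left_cancel₀ hpos4.ne' h1
    rw [this, PiLp.single_apply]
    simp [Subtype.ext_iff]
  · intro k
    rw [hsf, H.exp_map _ (hmem k)]
  · intro u hu
    obtain ⟨t, ht, htu⟩ := exists_pos_smul_norm_lt u hpos
    have htu0 : t • u ∈ C.face 0 := mem_face_zero_of_norm_le hε
      (fun i hi => by rw [PiLp.smul_apply, hu i hi, smul_zero]) htu.le
    have hx := H.mapsTo_inv _ htu0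
    have h1 : ∀ k, t * inner ℝ (f k) u = T' (t • u) k.1 := fun k => by
      rw [← hinner k _ hx, H.right_inv _ htu0, inner_smul_right]
    have h2 : ‖T' (t • u)‖ = t * ‖u‖ := by
      rw [H.symm.norm_map htu0, norm_smul, Real.norm_of_nonneg ht.le]
    have h3 := norm_sq_eq_sum_not_fixed (mem_face_zero.1 hx).2
    rw [h2] at h3
    have h4 : t ^ 2 * ∑ k, inner ℝ (f k) u ^ 2 = t ^ 2 * ‖u‖ ^ 2 := by
      rw [← mul_pow, h3, Finset.mul_sum]
      refine Finset.sum_congr rfl fun k _ => ?_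
      rw [← mul_pow, h1]
    exact mul_left_cancel₀ (by positivity) h4

/-- The linear map to a Hilbert space with an orthonormal family `b` that is determined by a frame
and by the labels of the edges. -/
noncomputable def develop {H : Type*} [NormedAddCommGroup H] [InnerProductSpace ℝ H]
    (R C : K.Chart p) (ε : ℝ) (f : {k // ¬ R.Fixed k} → C.Vec)
    (b : Fin (K.dim R.cell) ⊕ X → H) : C.Vec →ₗ[ℝ] H :=
  ∑ κ : {k // ¬ R.Fixed k} ⊕ {i // C.Fixed i},
    (innerₛₗ ℝ (Sum.elim f (fun i => C.edge i.1) κ)).smulRight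
      (b (Sum.map (fun k => k.1) (fun i => C.label ε i.1) κ))

section Develop

variable {H : Type*} [NormedAddCommGroup H] [InnerProductSpace ℝ H]
  {f : {k // ¬ R.Fixed k} → C.Vec} {b : Fin (K.dim R.cell) ⊕ X → H}

theorem develop_apply (v : C.Vec) :
    R.develop C ε f b v = ∑ κ : {k // ¬ R.Fixed k} ⊕ {i // C.Fixed i},
      inner ℝ (Sum.elim f (fun i => C.edge i.1) κ) v •
        b (Sum.map (fun k => k.1) (fun i => C.label ε i.1) κ) := by
  simp [develop, LinearMap.sum_apply]

theorem develop_apply' (v : C.Vec) :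
    R.develop C ε f b v = ∑ k, inner ℝ (f k) v • b (Sum.inl k.1) +
      ∑ i : {i // C.Fixed i}, (C.sgn i * v i) • b (Sum.inr (C.label ε i.1)) := by
  rw [develop_apply, Fintype.sum_sum_type]
  congr 1
  refine Finset.sum_congr rfl fun i _ => ?_
  rw [Sum.elim_inr, real_inner_comm, inner_edge]
  rfl

/-- Distinct edges of `C` go to distinct basis vectors by `label_injective`. Pythagoras then adds up
the edge coordinates and, by Parseval for the frame, the tangential part. -/
theorem norm_develop (hX : IsCAT0 X) (hε : K.IsClearance p ε) (hf : R.IsFrame C ε f)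
    (hb : Orthonormal ℝ b) (v : C.Vec) : ‖R.develop C ε f b v‖ = ‖v‖ := by
  have hinj : Function.Injective (Sum.map (fun k : {k // ¬ R.Fixed k} => k.1)
      (fun i : {i // C.Fixed i} => C.label ε i.1)) :=
    Function.Injective.sumMap Subtype.val_injective fun i j h =>
      Subtype.ext (label_injective hX hε i.2 j.2 h)
  rw [← sq_eq_sq₀ (norm_nonneg _) (norm_nonneg _), ← real_inner_self_eq_norm_sq, develop_apply]
  have h1 := (hb.comp _ hinj).inner_sum
    (fun κ => inner ℝ (Sum.elim f (fun i : {i // C.Fixed i} => C.edge i) κ) v)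
    (fun κ => inner ℝ (Sum.elim f (fun i : {i // C.Fixed i} => C.edge i) κ) v) Finset.univ
  simp only [Function.comp_apply] at h1
  rw [h1, Fintype.sum_sum_type]
  simp only [Sum.elim_inl, Sum.elim_inr, conj_trivial]
  let u : C.Vec := WithLp.toLp 2 fun i => if C.Fixed i then 0 else v i
  have hu : ∀ i, C.Fixed i → u i = 0 := fun i hi => by simp [u, hi]
  have hfu : ∀ k, inner ℝ (f k) v = inner ℝ (f k) u := fun k => by
    rw [PiLp.inner_apply, PiLp.inner_apply]
    refine Finset.sum_congr rfl fun i _ => ?_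
    by_cases hi : C.Fixed i
    · rw [hf.apply_fixed k i hi, inner_zero_left, inner_zero_left]
    · simp [u, hi]
  rw [EuclideanSpace.real_norm_sq_eq v, ← Fintype.sum_subtype_add_sum_subtype C.Fixed, add_comm]
  congr 1
  · refine Finset.sum_congr rfl fun i _ => ?_
    rw [real_inner_comm, inner_edge]
    linear_combination (v i) ^ 2 * i.2.sgn_mul_self
  · have h2 := hf.parseval u hu
    rw [norm_sq_eq_sum_not_fixed hu] at h2
    calc ∑ k, inner ℝ (f k) v * inner ℝ (f k) v = ∑ k, inner ℝ (f k) u ^ 2 :=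
          Finset.sum_congr rfl fun k _ => by rw [hfu, sq]
      _ = ∑ k : {k // ¬ C.Fixed k}, u k ^ 2 := h2
      _ = _ := Finset.sum_congr rfl fun k _ => by simp [u, k.2]

theorem develop_edge (hf : R.IsFrame C ε f) {i : Fin (K.dim C.cell)} (hi : C.Fixed i) :
    R.develop C ε f b (C.edge i) = b (Sum.inr (C.label ε i)) := by
  rw [develop_apply', Finset.sum_eq_zero, zero_add, Fintype.sum_eq_single ⟨i, hi⟩]
  · rw [edge_apply_self, hi.sgn_mul_self, one_smul]
  · intro j hj
    rw [edge_apply_of_ne fun h => hj (Subtype.ext h), mul_zero, zero_smul]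
  · intro k _
    rw [inner_edge, hf.apply_fixed k i hi, mul_zero, zero_smul]

theorem inner_develop_of_apply_fixed (hb : Orthonormal ℝ b) {u : C.Vec}
    (hu : ∀ i, C.Fixed i → u i = 0) (y : X) :
    inner ℝ (R.develop C ε f b u) (b (Sum.inr y)) = 0 := by
  rw [develop_apply', Finset.sum_eq_zero (s := (Finset.univ : Finset {i // C.Fixed i}))
    (fun i _ => by rw [hu i.1 i.2, mul_zero, zero_smul]), add_zero, sum_inner]
  refine Finset.sum_eq_zero fun k _ => ?_
  rw [inner_smul_left, hb.2 (by simp), mul_zero]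

/-- The transition map of the two points carries frame to frame and edges to edges with the same
labels, so all coordinates of `v` and `v'` in the common basis agree. -/
theorem develop_eq_of_exp_eq (hX : IsCAT0 X) (hε : K.IsClearance p ε) (hf : R.IsFrame C ε f)
    {f' : {k // ¬ R.Fixed k} → C'.Vec} (hf' : R.IsFrame C' ε f') {v : C.Vec} {v' : C'.Vec}
    (hv : C.InCone v) (hv' : C'.InCone v') (hvε : ‖v‖ < ε / 2) (hvε' : ‖v'‖ < ε / 2)
    (h : C.exp v = C'.exp v') : R.develop C ε f b v = R.develop C' ε f' b v' := by
  have hpos := hε.pos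
  rw [develop_apply', develop_apply']
  congr 1
  · obtain ⟨T, T', H⟩ := exists_isTransition hε hv hv' hvε hvε' h
    refine Finset.sum_congr rfl fun k _ => ?_
    congr 1
    have hz : ∀ i, C.Fixed i → ((ε / 4) • f k) i = 0 := fun i hi => by
      rw [PiLp.smul_apply, hf.apply_fixed k i hi, smul_zero]
    have hz' : ∀ i, C'.Fixed i → ((ε / 4) • f' k) i = 0 := fun i hi => by
      rw [PiLp.smul_apply, hf'.apply_fixed k i hi, smul_zero]
    have hn : ‖(ε / 4) • f k‖ = ε / 4 := by
      rw [norm_smul, hf.orthonormal.1 k, mul_one, Real.norm_of_nonneg (by linarith)]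
    have hn' : ‖(ε / 4) • f' k‖ = ε / 4 := by
      rw [norm_smul, hf'.orthonormal.1 k, mul_one, Real.norm_of_nonneg (by linarith)]
    have hm := mem_face_zero_of_norm_le hε hz (by linarith)
    have hmv := face_zero_subset hε (show ‖v‖ < ε by linarith) hm
    have hT0 := (mem_face_zero.1 (H.map_face_zero hε (by linarith) (by linarith) hm)).2
    -- Both vectors represent the same point of the open face of `p`, namely that of the `k`-th axis
    -- of `R`.
    have hT : T ((ε / 4) • f k) = (ε / 4) • f' k := by
      refine eq_of_exp_eq hε (inCone_of_apply_fixed hT0) (inCone_of_apply_fixed hz')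
        (by rw [H.norm_map hmv]; linarith) (by linarith)
        (fun i hi => by rw [hT0 i hi, hz' i hi]) ?_
      rw [H.exp_map _ hmv, hf.exp_eq, hf'.exp_eq]
    have h1 := H.inner_map _ hmv _ H.base_mem
    rw [H.map_base, hT, inner_smul_left, inner_smul_left] at h1
    exact (mul_left_cancel₀ (by simp [hpos.ne']) h1).symm
  · have key : ∀ {C C' : K.Chart p} {v : C.Vec} {v' : C'.Vec}, C.InCone v → C'.InCone v' →
        ‖v‖ < ε / 2 → ‖v'‖ < ε / 2 → C.exp v = C'.exp v' → ∀ i : {i // C.Fixed i},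
        (C.sgn i * v i) • b (Sum.inr (C.label ε i.1)) ≠ 0 →
        ∃ j : {j // C'.Fixed j}, C'.label ε j.1 = C.label ε i.1 ∧
          C'.sgn j * v' j = C.sgn i * v i := by
      intro C C' v v' hv hv' hvε hvε' h i hi
      have hvi : v i ≠ 0 := fun h => hi (by rw [h, mul_zero, zero_smul])
      obtain ⟨j, hj, h1, h2⟩ := exists_label_eq hε hv hv' hvε hvε' h i.2 hvi
      exact ⟨⟨j, hj⟩, h1, h2⟩
    have key1 := key hv hv' hvε hvε' h
    have key2 := key hv' hv hvε' hvε h.symm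
    choose g hg1 hg2 using key1
    -- Only nonzero coordinates can be matched: the two cubes may have different further edges.
    refine Finset.sum_bij_ne_zero (fun i _ hi => g i hi) (fun _ _ _ => Finset.mem_univ _) ?_ ?_ ?_
    · intro i₁ _ h₁ i₂ _ h₂ he
      have := (hg1 i₁ h₁).symm.trans ((congrArg (fun j => C'.label ε j.1) he).trans (hg1 i₂ h₂))
      exact Subtype.ext (label_injective hX hε i₁.2 i₂.2 this)
    · intro j _ hj
      obtain ⟨i, hi1, hi2⟩ := key2 j hj
      have hi : (C.sgn i * v i) • b (Sum.inr (C.label ε i.1)) ≠ 0 := by rwa [hi1, hi2]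
      exact ⟨i, Finset.mem_univ _, hi, Subtype.ext (label_injective hX hε (g i hi).2 j.2
        ((hg1 i hi).trans hi1))⟩
    · intro i _ hi
      rw [hg1, hg2]

end Develop

end Chart

/-- Linear isometric embeddings of the tangent spaces of all charts at `p` that agree on common
faces, send the edges to members of an orthonormal family, and send the directions tangent to the
open face of `p` to vectors orthogonal to this family. -/
structure IsDevelopment (K : CubeComplex.{u, v} X) (p : X) (ε : ℝ) {H : Type*}
    [NormedAddCommGroup H] [InnerProductSpace ℝ H] (b : X → H)
    (L : ∀ C : K.Chart p, C.Vec →ₗᵢ[ℝ] H) : Prop where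
  orthonormal : Orthonormal ℝ b
  map_edge : ∀ (C : K.Chart p) (i), C.Fixed i → L C (C.edge i) = b (C.label ε i)
  inner_eq_zero : ∀ (C : K.Chart p) (u : C.Vec), (∀ i, C.Fixed i → u i = 0) →
    ∀ y, inner ℝ (L C u) (b y) = 0
  compat : ∀ (C C' : K.Chart p) (v : C.Vec) (v' : C'.Vec), C.InCone v → C'.InCone v' →
    ‖v‖ < ε / 2 → ‖v'‖ < ε / 2 → C.exp v = C'.exp v' → L C v = L C' v'

/-- All of `X` serves as index set for the labels, so `H` is an `ℓ²` space in the universe of `X`.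
-/
theorem exists_isDevelopment (K : CubeComplex.{u, v} X) (hX : IsCAT0 X)
    (hε : K.IsClearance p ε) :
    ∃ (H : Type u) (_ : NormedAddCommGroup H) (_ : InnerProductSpace ℝ H) (_ : CompleteSpace H)
      (b : X → H) (L : ∀ C : K.Chart p, C.Vec →ₗᵢ[ℝ] H), K.IsDevelopment p ε b L := by
  obtain ⟨a, x, hx, hxp⟩ := K.cover p
  let R : K.Chart p := ⟨a, x, hx, hxp⟩
  let B : HilbertBasis (Fin (K.dim R.cell) ⊕ X) ℝ (lp (fun _ : Fin (K.dim R.cell) ⊕ X => ℝ) 2) :=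
    ⟨LinearIsometryEquiv.refl ℝ _⟩
  have hB := B.orthonormal
  choose f hf using fun C => Chart.exists_isFrame hε R C
  refine ⟨lp (fun _ : Fin (K.dim R.cell) ⊕ X => ℝ) 2, inferInstance, inferInstance, inferInstance,
    fun y => B (Sum.inr y), fun C => ⟨R.develop C ε (f C) B, Chart.norm_develop hX hε (hf C) hB⟩,
    hB.comp _ Sum.inr_injective, ?_, ?_, ?_⟩
  · intro C i hi
    exact Chart.develop_edge (hf C) hi
  · intro C u hu y
    exact Chart.inner_develop_of_apply_fixed hB hu y
  · intro C C' v v' hv hv' hvε hvε' h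
    exact Chart.develop_eq_of_exp_eq hX hε (hf C) (hf C') hv hv' hvε hvε' h

end CubeComplex

/-! ### Distances between points near `p` in terms of a development -/

/-- The length of a broken path through a point `U` of the common part of two orthants. -/
theorem norm_sub_add_norm_sub_sq_le {H : Type*} [NormedAddCommGroup H] [InnerProductSpace ℝ H]
    {Vm V₁ Wm W₁ : H} (h1 : inner ℝ V₁ Vm = 0) (h2 : inner ℝ V₁ Wm = 0)
    (h3 : inner ℝ V₁ W₁ = 0) (h4 : inner ℝ W₁ Vm = 0) (h5 : inner ℝ W₁ Wm = 0) {α β : ℝ}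
    (hα : 0 ≤ α) (hβ : 0 ≤ β) (hαβ : α + β = 1) (hαV : α * (‖V₁‖ + ‖W₁‖) = ‖V₁‖) :
    (‖Vm + V₁ - (β • Vm + α • Wm)‖ + ‖Wm + W₁ - (β • Vm + α • Wm)‖) ^ 2 ≤
      (‖Vm + V₁‖ + ‖Wm + W₁‖) ^ 2 - 4 * inner ℝ (Vm + V₁) (Wm + W₁) := by
  set S := ‖V₁‖ + ‖W₁‖ with hS
  have hβW : β * S = ‖W₁‖ := by
    have : β * S = S - α * S := by rw [← one_sub_mul]; congr 1; linarith
    rw [this, hαV, hS]; ring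
  have hβ' : β = 1 - α := by linarith
  have pyth : ∀ x y : H, inner ℝ y x = 0 → ‖x + y‖ ^ 2 = ‖x‖ ^ 2 + ‖y‖ ^ 2 := fun x y h => by
    rw [norm_add_sq_real, real_inner_comm, h]; ring
  -- Unfold `V₁` and `W₁` to opposite sides of the common part: the broken path becomes a straight
  -- segment of length `N`, divided by `U` in the ratio `α : β`.
  set N := Real.sqrt (‖Vm - Wm‖ ^ 2 + S ^ 2) with hN
  have hN2 : N ^ 2 = ‖Vm - Wm‖ ^ 2 + S ^ 2 := Real.sq_sqrt (by positivity)
  have e1 : ‖Vm + V₁ - (β • Vm + α • Wm)‖ = α * N := by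
    rw [← sq_eq_sq₀ (norm_nonneg _) (mul_nonneg hα (Real.sqrt_nonneg _)), mul_pow, hN2]
    have : Vm + V₁ - (β • Vm + α • Wm) = α • (Vm - Wm) + V₁ := by rw [hβ']; module
    rw [this, pyth _ _ (by rw [inner_smul_right, inner_sub_right, h1, h2]; ring), norm_smul,
      Real.norm_of_nonneg hα]
    rw [show ‖V₁‖ ^ 2 = (α * S) ^ 2 by rw [hαV]]
    ring
  have e2 : ‖Wm + W₁ - (β • Vm + α • Wm)‖ = β * N := by
    rw [← sq_eq_sq₀ (norm_nonneg _) (mul_nonneg hβ (Real.sqrt_nonneg _)), mul_pow, hN2]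
    have : Wm + W₁ - (β • Vm + α • Wm) = -(β • (Vm - Wm)) + W₁ := by rw [hβ']; module
    rw [this, pyth _ _ (by rw [inner_neg_right, inner_smul_right, inner_sub_right, h4, h5]; ring),
      norm_neg, norm_smul, Real.norm_of_nonneg hβ]
    rw [show ‖W₁‖ ^ 2 = (β * S) ^ 2 by rw [hβW]]
    ring
  rw [e1, e2, ← add_mul, hαβ, one_mul, hN2]
  have e3 : inner ℝ (Vm + V₁) (Wm + W₁) = inner ℝ Vm Wm := by
    rw [inner_add_left, inner_add_right, inner_add_right, h3, h2, real_inner_comm W₁ Vm, h4]; ring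
  have e4 := pyth Vm V₁ h1
  have e5 := pyth Wm W₁ h5
  have e6 := norm_sub_sq_real Vm Wm
  have hcs : ‖Vm‖ * ‖Wm‖ + ‖V₁‖ * ‖W₁‖ ≤ ‖Vm + V₁‖ * ‖Wm + W₁‖ := by
    refine abs_le_of_sq_le_sq' ?_ (by positivity) |>.2
    rw [mul_pow, e4, e5]
    nlinarith [sq_nonneg (‖Vm‖ * ‖W₁‖ - ‖V₁‖ * ‖Wm‖)]
  have hvw := real_inner_le_norm Vm Wm
  rw [e3, e6, hS]
  nlinarith

namespace CubeComplex

variable {X : Type u} [MetricSpace X] {K : CubeComplex.{u, v} X} {p : X} {ε : ℝ}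

namespace Chart

variable {C C' : K.Chart p}

theorem inCone_sum {ι : Type*} (s : Finset ι) (f : ι → C.Vec) (h : ∀ i ∈ s, C.InCone (f i)) :
    C.InCone (∑ i ∈ s, f i) :=
  Finset.sum_induction f C.InCone (fun _ _ => InCone.add) inCone_zero h

/-- The component of `v` tangent to the open face of the base point. -/
noncomputable def tangentPart (v : C.Vec) : C.Vec :=
  WithLp.toLp 2 fun i => if C.Fixed i then 0 else v i

theorem tangentPart_apply_fixed (v : C.Vec) (i : Fin (K.dim C.cell)) (hi : C.Fixed i) :
    tangentPart v i = 0 := by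
  simp [tangentPart, hi]

theorem eq_tangentPart_add_sum (v : C.Vec) :
    v = tangentPart v + ∑ i : {i // C.Fixed i}, (C.sgn i * v i) • C.edge i.1 := by
  ext k
  rw [PiLp.add_apply, WithLp.ofLp_sum, Finset.sum_apply]
  by_cases hk : C.Fixed k
  · rw [tangentPart_apply_fixed v k hk, zero_add, Fintype.sum_eq_single ⟨k, hk⟩]
    · rw [PiLp.smul_apply, edge_apply_self, smul_eq_mul]
      linear_combination (-v k) * hk.sgn_mul_self
    · intro i hi
      rw [PiLp.smul_apply, edge_apply_of_ne fun h => hi (Subtype.ext h.symm), smul_zero]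
  · rw [Finset.sum_eq_zero, add_zero]
    · simp [tangentPart, hk]
    · intro i _
      rw [PiLp.smul_apply, edge_apply_of_ne (fun h => hk (by rw [h]; exact i.2)), smul_zero]

end Chart

/-! ### Recovering points and distances from the development. -/

namespace IsDevelopment

variable {H : Type*} [NormedAddCommGroup H] [InnerProductSpace ℝ H] {b : X → H}
  {L : ∀ C : K.Chart p, C.Vec →ₗᵢ[ℝ] H} {C C' : K.Chart p}

/-- The maps `L C` glue to one map near `p` that is `1`-Lipschitz on every cube, hence for the
intrinsic metric. The bound `ε / 8` keeps short strings between the two points within `ε / 2` of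
`p`. -/
theorem norm_map_sub_le (hL : K.IsDevelopment p ε b L) (hε : K.IsClearance p ε) {v : C.Vec}
    {v' : C'.Vec} (hv : C.InCone v) (hv' : C'.InCone v') (hvε : ‖v‖ < ε / 8)
    (hvε' : ‖v'‖ < ε / 8) : ‖L C v - L C' v'‖ ≤ dist (C.exp v) (C'.exp v') := by
  have hpos := hε.pos
  classical
  let F : X → H := fun q =>
    if h : ∃ (C : K.Chart p) (v : C.Vec), C.InCone v ∧ ‖v‖ < ε / 2 ∧ C.exp v = q
    then L h.choose h.choose_spec.choose else 0
  have hF : ∀ (C : K.Chart p) (v : C.Vec), C.InCone v → ‖v‖ < ε / 2 → F (C.exp v) = L C v := by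
    intro C v hv hvε
    have h : ∃ (C' : K.Chart p) (v' : C'.Vec), C'.InCone v' ∧ ‖v'‖ < ε / 2 ∧
      C'.exp v' = C.exp v := ⟨C, v, hv, hvε, rfl⟩
    have hs := h.choose_spec.choose_spec
    simp only [F, dif_pos h]
    exact hL.compat _ _ _ _ hs.1 hv hs.2.1 hvε hs.2.2
  have hp : ∀ {C : K.Chart p} {v : C.Vec}, C.InCone v → ‖v‖ < ε / 8 →
      dist p (C.exp v) < ε / 8 := by
    intro C v hv hvε
    have := Chart.dist_exp_le (C := C) (v := 0) (w := v) (by simpa using C.mem)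
      (hv.mem_unitCube hε (by linarith))
    rw [Chart.exp_zero, zero_sub, norm_neg] at this
    linarith
  have h1 := hp hv hvε
  have h2 := hp hv' hvε'
  have h3 := dist_triangle_left (C.exp v) (C'.exp v') p
  have := hε.dist_map_exp_le (ρ := ε / 2) (by linarith) F
    (fun C v w hv hw hvε hwε => by
      rw [hF C v hv hvε, hF C w hw hwε, dist_eq_norm, ← map_sub, (L C).norm_map])
    (q := C.exp v) (r := C'.exp v') (by linarith)
  rwa [hF C v hv (by linarith), hF C' v' hv' (by linarith), dist_eq_norm] at this

/-- So short segments in a chart at `p` are geodesics of `X`. -/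
theorem norm_sub_le_dist (hL : K.IsDevelopment p ε b L) (hε : K.IsClearance p ε) {v w : C.Vec}
    (hv : C.InCone v) (hw : C.InCone w) (hvε : ‖v‖ < ε / 8)
    (hwε : ‖w‖ < ε / 8) : ‖v - w‖ ≤ dist (C.exp v) (C.exp w) := by
  have := hL.norm_map_sub_le hε hv hw hvε hwε
  rwa [← map_sub, (L C).norm_map] at this

theorem inner_label (hL : K.IsDevelopment p ε b L) (v : C.Vec) {i : Fin (K.dim C.cell)}
    (hi : C.Fixed i) : inner ℝ (L C v) (b (C.label ε i)) = C.sgn i * v i := by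
  rw [← hL.map_edge C i hi, (L C).inner_map_map, Chart.inner_edge]

theorem inner_eq_zero_of_forall_label_ne (hL : K.IsDevelopment p ε b L) {y : X}
    (hy : ∀ i, C.Fixed i → C.label ε i ≠ y) (v : C.Vec) : inner ℝ (L C v) (b y) = 0 := by
  rw [Chart.eq_tangentPart_add_sum v, map_add, inner_add_left,
    hL.inner_eq_zero C _ (Chart.tangentPart_apply_fixed v), zero_add, map_sum, sum_inner]
  refine Finset.sum_eq_zero fun i _ => ?_
  rw [map_smul, hL.map_edge C i.1 i.2, inner_smul_left, hL.orthonormal.2 (hy i.1 i.2), mul_zero]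

theorem exists_tangent_map_eq (hL : K.IsDevelopment p ε b L) (hε : K.IsClearance p ε) {u : C.Vec}
    (hu : ∀ i, C.Fixed i → u i = 0) (C' : K.Chart p) :
    ∃ u' : C'.Vec, (∀ i, C'.Fixed i → u' i = 0) ∧ L C' u' = L C u ∧
      (‖u‖ < ε / 2 → C'.exp u' = C.exp u) := by
  have hpos := hε.pos
  obtain ⟨T, T', HT⟩ := Chart.exists_isTransition_zero hε C C'
  have key : ∀ w : C.Vec, (∀ i, C.Fixed i → w i = 0) → ‖w‖ < ε / 2 →
      (∀ i, C'.Fixed i → T w i = 0) ∧ L C' (T w) = L C w ∧ C'.exp (T w) = C.exp w := by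
    intro w hw hwε
    have hm := Chart.mem_face_zero_of_norm_le hε hw (by linarith)
    have hT := (Chart.mem_face_zero.1 (HT.mapsTo _ hm)).2
    have he := HT.exp_map _ hm
    exact ⟨hT, hL.compat _ _ _ _ (Chart.inCone_of_apply_fixed hT) (Chart.inCone_of_apply_fixed hw)
      (by rwa [HT.norm_map hm]) hwε he, he⟩
  by_cases hsmall : ‖u‖ < ε / 2
  · obtain ⟨h1, h2, h3⟩ := key u hu hsmall
    exact ⟨T u, h1, h2, fun _ => h3⟩
  -- The transition map is defined only near the base point, so a large vector is shrunk, moved and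
  -- rescaled.
  · obtain ⟨t, ht, htu⟩ := Chart.exists_pos_smul_norm_lt u (half_pos hpos)
    obtain ⟨h1, h2, -⟩ := key (t • u)
      (fun i hi => by rw [PiLp.smul_apply, hu i hi, smul_zero]) htu
    refine ⟨t⁻¹ • T (t • u), fun i hi => by rw [PiLp.smul_apply, h1 i hi, smul_zero], ?_,
      fun h => absurd h hsmall⟩
    rw [map_smul, h2, map_smul, inv_smul_smul₀ ht.ne']

/-- Induction on the number of edges involved. Write `v = a • edge i + r`, the midpoint of `(2 * a)
• edge i` and `2 • r`. The first point is shared by both charts because the edges have the same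
label, the second by induction, and uniqueness of geodesics identifies the midpoints. Each doubling
costs a factor `2`, whence `2 ^ m`. -/
theorem exp_eq_of_map_eq (hL : K.IsDevelopment p ε b L) (hX : IsCAT0 X) (hε : K.IsClearance p ε)
    (m : ℕ) : ∀ {v : C.Vec} {v' : C'.Vec}, C.InCone v → C'.InCone v' →
    (Finset.univ.filter fun i => C.Fixed i ∧ v i ≠ 0).card ≤ m → 2 ^ m * ‖v‖ < ε / 8 →
    L C v = L C' v' → C.exp v = C'.exp v' := by
  have hpos := hε.pos
  induction m with
  | zero =>
    intro v v' hv hv' hcard hn h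
    have hfree : ∀ i, C.Fixed i → v i = 0 := by
      intro i hi
      by_contra hvi
      have : i ∈ Finset.univ.filter fun i => C.Fixed i ∧ v i ≠ 0 := by simp [hi, hvi]
      have := Finset.card_pos.2 ⟨i, this⟩
      omega
    obtain ⟨u', -, h2, h3⟩ := hL.exists_tangent_map_eq hε hfree C'
    rw [← (L C').injective (h2.trans h), h3 (by rw [pow_zero, one_mul] at hn; linarith)]
  | succ m ih =>
    intro v v' hv hv' hcard hn h
    by_cases hfree : ∀ i, C.Fixed i → v i = 0
    · obtain ⟨u', -, h2, h3⟩ := hL.exists_tangent_map_eq hε hfree C'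
      rw [← (L C').injective (h2.trans h), h3 (lt_of_le_of_lt
        (le_mul_of_one_le_left (norm_nonneg _) (one_le_pow₀ one_le_two)) (hn.trans (by linarith)))]
    push Not at hfree
    obtain ⟨i, hi, hvi⟩ := hfree
    set a := C.sgn i * v i with ha
    have ha0 : 0 ≤ a := hv i hi
    have hane : a ≠ 0 := mul_ne_zero hi.sgn_ne_zero hvi
    -- Otherwise the image of `v'` would be orthogonal to the basis vector of the edge `i`, on which
    -- the image of `v` has coordinate `a ≠ 0`.
    obtain ⟨j, hj, hlab⟩ : ∃ j, C'.Fixed j ∧ C'.label ε j = C.label ε i := by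
      by_contra! hcon
      have := hL.inner_eq_zero_of_forall_label_ne hcon v'
      rw [← h, hL.inner_label v hi] at this
      exact hane this
    have haj : C'.sgn j * v' j = a := by
      rw [← hL.inner_label v' hj, ← h, hlab, hL.inner_label v hi]
    have hapos : (0 : ℝ) ≤ 2 * a := by linarith
    have han : a ≤ ‖v‖ := by
      have := abs_coord_le_norm v i
      rwa [← abs_of_nonneg ha0, ha, abs_mul, hi.abs_sgn, one_mul]
    set r := v - a • C.edge i with hr
    set r' := v' - a • C'.edge j with hr'
    have hri : r i = 0 := by
      rw [hr, PiLp.sub_apply, PiLp.smul_apply, Chart.edge_apply_self, smul_eq_mul, ha]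
      linear_combination (-v i) * hi.sgn_mul_self
    have hrk : ∀ k, k ≠ i → r k = v k := fun k hk => by
      rw [hr, PiLp.sub_apply, PiLp.smul_apply, Chart.edge_apply_of_ne hk]; simp
    have hrj' : r' j = 0 := by
      rw [hr', PiLp.sub_apply, PiLp.smul_apply, Chart.edge_apply_self, smul_eq_mul, ← haj]
      linear_combination (-v' j) * hj.sgn_mul_self
    have hrk' : ∀ k, k ≠ j → r' k = v' k := fun k hk => by
      rw [hr', PiLp.sub_apply, PiLp.smul_apply, Chart.edge_apply_of_ne hk]; simp
    have hrc : C.InCone r := fun k hk => by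
      by_cases hki : k = i
      · subst hki; rw [hri, mul_zero]
      · rw [hrk k hki]; exact hv k hk
    have hrc' : C'.InCone r' := fun k hk => by
      by_cases hkj : k = j
      · subst hkj; rw [hrj', mul_zero]
      · rw [hrk' k hkj]; exact hv' k hk
    have hrn : ‖r‖ ≤ ‖v‖ := by
      refine (sq_le_sq₀ (norm_nonneg _) (norm_nonneg _)).1 ?_
      rw [hr, norm_sub_sq_real, inner_smul_right, Chart.inner_edge, ← ha,
        Chart.norm_smul_edge hi ha0]
      nlinarith
    have hLr : L C r = L C' r' := by
      rw [hr, hr', map_sub, map_sub, map_smul, map_smul, hL.map_edge C i hi, hL.map_edge C' j hj,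
        hlab, h]
    have h2c := hrc.smul (t := 2) zero_le_two
    have h2c' := hrc'.smul (t := 2) zero_le_two
    have hL2 : L C ((2 : ℝ) • r) = L C' ((2 : ℝ) • r') := by rw [map_smul, map_smul, hLr]
    have h2n : ‖(2 : ℝ) • r‖ = 2 * ‖r‖ := by rw [norm_smul]; norm_num
    have h2n' : ‖(2 : ℝ) • r'‖ = 2 * ‖r‖ := by
      rw [← (L C').norm_map, ← hL2, (L C).norm_map, h2n]
    have hpow : (1 : ℝ) ≤ 2 ^ m := one_le_pow₀ one_le_two
    have hvsmall : 2 * ‖v‖ < ε / 8 := by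
      rw [pow_succ] at hn
      nlinarith [norm_nonneg v]
    have hB : C.exp ((2 : ℝ) • r) = C'.exp ((2 : ℝ) • r') := by
      refine ih h2c h2c' ?_ ?_ hL2
      · refine Nat.le_of_lt_succ (lt_of_lt_of_le (Finset.card_lt_card ?_) hcard)
        rw [Finset.ssubset_iff_of_subset]
        · exact ⟨i, by simp [hi, hvi], by simp [hri]⟩
        · intro k hk
          have hk := (Finset.mem_filter.1 hk).2
          rw [PiLp.smul_apply, smul_eq_mul] at hk
          have hki : k ≠ i := fun hki => hk.2 (by rw [hki, hri, mul_zero])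
          rw [hrk k hki] at hk
          exact Finset.mem_filter.2 ⟨Finset.mem_univ _, hk.1, fun h0 => hk.2 (by rw [h0, mul_zero])⟩
      · rw [h2n]
        rw [pow_succ] at hn
        nlinarith [norm_nonneg r, norm_nonneg v]
    have hA : C.exp ((2 * a) • C.edge i) = C'.exp ((2 * a) • C'.edge j) :=
      Chart.exp_smul_edge_eq hε hi hj hlab.symm hapos (by linarith)
    have hLA : L C ((2 * a) • C.edge i) = L C' ((2 * a) • C'.edge j) := by
      rw [map_smul, map_smul, hL.map_edge C i hi, hL.map_edge C' j hj, hlab]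
    have hAc : C.InCone ((2 * a) • C.edge i) := (Chart.inCone_edge i).smul hapos
    have hAc' : C'.InCone ((2 * a) • C'.edge j) := (Chart.inCone_edge j).smul hapos
    have hAn := Chart.norm_smul_edge hi hapos
    have hAn' := Chart.norm_smul_edge hj hapos
    have hdist := hL.norm_sub_le_dist hε hAc h2c (by linarith) (by linarith)
    have hseg := Chart.exp_segment_eq hX (hAc.mem_unitCube hε (by linarith))
      (h2c.mem_unitCube hε (by linarith)) (hAc'.mem_unitCube hε (by linarith))
      (h2c'.mem_unitCube hε (by linarith)) hA hB hdist
      (by rw [← (L C').norm_map, map_sub, ← hLA, ← hL2, ← map_sub, (L C).norm_map]; exact hdist)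
      (θ := 1 / 2) (by norm_num) (by norm_num)
    have e1 : (2 * a) • C.edge i + (1 / 2 : ℝ) • ((2 : ℝ) • r - (2 * a) • C.edge i) = v := by
      rw [hr]; module
    have e2 : (2 * a) • C'.edge j + (1 / 2 : ℝ) • ((2 : ℝ) • r' - (2 * a) • C'.edge j) = v' := by
      rw [hr']; module
    rwa [e1, e2] at hseg

/-- Decomposition of a vector of one chart into a vector of the common part of two charts and a
vector that is orthogonal to the second chart. -/
theorem exists_common_add_orthogonal (hL : K.IsDevelopment p ε b L) (hε : K.IsClearance p ε)
    {v : C.Vec} (hv : C.InCone v) (C' : K.Chart p) :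
    ∃ (vm v₁ : C.Vec) (vm' : C'.Vec), v = vm + v₁ ∧ C.InCone vm ∧ C'.InCone vm' ∧
      L C' vm' = L C vm ∧ ∀ x, inner ℝ (L C v₁) (L C' x) = 0 := by
  classical
  obtain ⟨u', hu', hLu', -⟩ :=
    hL.exists_tangent_map_eq hε (Chart.tangentPart_apply_fixed v) C'
  let Common : {i // C.Fixed i} → Prop := fun i => ∃ j, C'.Fixed j ∧ C'.label ε j = C.label ε i.1
  have hcone : ∀ i : {i // C.Fixed i}, C.InCone ((C.sgn i * v i) • C.edge i.1) := fun i =>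
    (Chart.inCone_edge i.1).smul (hv i.1 i.2)
  refine ⟨Chart.tangentPart v +
      ∑ i ∈ Finset.univ.filter Common, (C.sgn i * v i) • C.edge i.1,
    ∑ i ∈ Finset.univ.filter fun i => ¬ Common i, (C.sgn i * v i) • C.edge i.1,
    u' + ∑ i : {i // C.Fixed i}, if h : Common i then (C.sgn i * v i) • C'.edge h.choose else 0,
    ?_, ?_, ?_, ?_, ?_⟩
  · rw [add_assoc, Finset.sum_filter_add_sum_filter_not]
    exact Chart.eq_tangentPart_add_sum v
  · exact (Chart.inCone_of_apply_fixed (Chart.tangentPart_apply_fixed v)).add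
      (Chart.inCone_sum _ _ fun i _ => hcone i)
  · refine (Chart.inCone_of_apply_fixed hu').add (Chart.inCone_sum _ _ fun i _ => ?_)
    split_ifs with h
    · exact (Chart.inCone_edge _).smul (hv i.1 i.2)
    · exact Chart.inCone_zero
  · rw [map_add, map_add, hLu', map_sum, map_sum, Finset.sum_filter]
    congr 1
    refine Finset.sum_congr rfl fun i _ => ?_
    split_ifs with h
    · rw [map_smul, map_smul, hL.map_edge C i.1 i.2, hL.map_edge C' _ h.choose_spec.1,
        h.choose_spec.2]
    · rw [map_zero]
  · intro x
    rw [map_sum, sum_inner]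
    refine Finset.sum_eq_zero fun i hi => ?_
    have hni := (Finset.mem_filter.1 hi).2
    rw [map_smul, inner_smul_left, hL.map_edge C i.1 i.2, real_inner_comm,
      hL.inner_eq_zero_of_forall_label_ne (fun j hj hlab => hni ⟨j, hj, hlab⟩), mul_zero]

/-- The path runs from `v` inside `C` to a point of the common part, then inside `C'` to `w`. That
the turning point is one point of `X`, seen as `z` in `C` and as `z'` in `C'`, is
`exp_eq_of_map_eq`, which asks for the factor `2 ^ K.dim C.cell`. -/
theorem dist_sq_le (hL : K.IsDevelopment p ε b L) (hX : IsCAT0 X) (hε : K.IsClearance p ε)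
    {v : C.Vec} {w : C'.Vec} (hv : C.InCone v) (hw : C'.InCone w)
    (hsmall : 2 ^ K.dim C.cell * (‖v‖ + ‖w‖) < ε / 8) :
    dist (C.exp v) (C'.exp w) ^ 2 ≤ (‖v‖ + ‖w‖) ^ 2 - 4 * inner ℝ (L C v) (L C' w) := by
  have hpos := hε.pos
  obtain ⟨vm, v₁, vm', rfl, hvm, hvm', hLv, horv⟩ := hL.exists_common_add_orthogonal hε hv C'
  obtain ⟨wm, w₁, wm', rfl, hwm, hwm', hLw, horw⟩ := hL.exists_common_add_orthogonal hε hw C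
  have h1 : inner ℝ (L C v₁) (L C vm) = 0 := by rw [← hLv]; exact horv _
  have h5 : inner ℝ (L C' w₁) (L C' wm) = 0 := by rw [← hLw]; exact horw _
  -- The ratio at which the unfolded segment crosses the common part; it is arbitrary when both
  -- orthogonal components vanish.
  obtain ⟨α, β, hα, hβ, hαβ, hαV⟩ : ∃ α β : ℝ, 0 ≤ α ∧ 0 ≤ β ∧ α + β = 1 ∧
      α * (‖L C v₁‖ + ‖L C' w₁‖) = ‖L C v₁‖ := by
    rcases eq_or_lt_of_le (add_nonneg (norm_nonneg (L C v₁)) (norm_nonneg (L C' w₁))) with h0 | h0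
    · refine ⟨0, 1, le_rfl, zero_le_one, zero_add _, ?_⟩
      linarith [norm_nonneg (L C v₁), norm_nonneg (L C' w₁)]
    · refine ⟨‖L C v₁‖ / (‖L C v₁‖ + ‖L C' w₁‖), ‖L C' w₁‖ / (‖L C v₁‖ + ‖L C' w₁‖),
        by positivity, by positivity, ?_, div_mul_cancel₀ _ h0.ne'⟩
      rw [← add_div, div_self h0.ne']
  have key := norm_sub_add_norm_sub_sq_le h1 (horv _) (horv w₁)
    (horw _) h5 hα hβ hαβ hαV
  set z : C.Vec := β • vm + α • wm' with hz
  set z' : C'.Vec := β • vm' + α • wm with hz'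
  have hLz : L C z = β • L C vm + α • L C' wm := by rw [hz, map_add, map_smul, map_smul, hLw]
  have hLz' : L C' z' = β • L C vm + α • L C' wm := by rw [hz', map_add, map_smul, map_smul, hLv]
  have hzc : C.InCone z := (hvm.smul hβ).add (hwm'.smul hα)
  have hzc' : C'.InCone z' := (hvm'.smul hβ).add (hwm.smul hα)
  have hle : ∀ {x y : H}, inner ℝ y x = 0 → ‖x‖ ≤ ‖x + y‖ := fun {x y} h => by
    refine (sq_le_sq₀ (norm_nonneg _) (norm_nonneg _)).1 ?_
    rw [norm_add_sq_real, real_inner_comm, h]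
    nlinarith [sq_nonneg ‖y‖]
  have hnv := hle h1
  have hnw := hle h5
  rw [← map_add, (L C).norm_map, (L C).norm_map] at hnv
  rw [← map_add, (L C').norm_map, (L C').norm_map] at hnw
  have hzn : ‖z‖ ≤ ‖vm + v₁‖ + ‖wm + w₁‖ := by
    rw [← (L C).norm_map, hLz]
    refine (norm_add_le _ _).trans (add_le_add ?_ ?_)
    · rw [norm_smul, Real.norm_of_nonneg hβ, (L C).norm_map]
      exact (mul_le_of_le_one_left (norm_nonneg _) (by linarith)).trans hnv
    · rw [norm_smul, Real.norm_of_nonneg hα, (L C').norm_map]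
      exact (mul_le_of_le_one_left (norm_nonneg _) (by linarith)).trans hnw
  have hzn' : ‖z'‖ = ‖z‖ := by rw [← (L C').norm_map, hLz', ← hLz, (L C).norm_map]
  have hpow : (1 : ℝ) ≤ 2 ^ K.dim C.cell := one_le_pow₀ one_le_two
  have hs : ‖vm + v₁‖ + ‖wm + w₁‖ < ε / 8 := (le_mul_of_one_le_left (by positivity) hpow).trans_lt
    hsmall
  have hexp : C.exp z = C'.exp z' := by
    refine hL.exp_eq_of_map_eq hX hε (K.dim C.cell) hzc hzc' ?_ ?_ (hLz.trans hLz'.symm)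
    · exact (Finset.card_le_univ _).trans (by simp)
    · exact (mul_le_mul_of_nonneg_left hzn (by positivity)).trans_lt hsmall
  have hvs := norm_nonneg (vm + v₁)
  have hws := norm_nonneg (wm + w₁)
  have hzm := hzc.mem_unitCube hε (by linarith)
  have hzm' := hzc'.mem_unitCube hε (by linarith)
  have d1 := Chart.dist_exp_le (hv.mem_unitCube hε (by linarith)) hzm
  have d2 := Chart.dist_exp_le (hw.mem_unitCube hε (by linarith)) hzm'
  rw [← (L C).norm_map, map_sub, hLz] at d1
  rw [← (L C').norm_map, map_sub, hLz', ← hexp] at d2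
  have d3 := dist_triangle_right (C.exp (vm + v₁)) (C'.exp (wm + w₁)) (C.exp z)
  rw [← map_add, ← map_add, (L C).norm_map, (L C').norm_map] at key
  refine (pow_le_pow_left₀ dist_nonneg (d3.trans (add_le_add d1 d2)) 2).trans ?_
  exact key

end IsDevelopment

end CubeComplex

/-! ### The tangent cone -/

namespace CubeComplex

variable {X : Type u} [MetricSpace X] {K : CubeComplex.{u, v} X} {p : X} {ε : ℝ}

theorem StartsAs.eventually {C : K.Chart p} {c : GeodesicFrom p} {v : C.Vec}
    (h : K.StartsAs c C.cell C.pt v) {η : ℝ} (hη : 0 < η) :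
    ∀ᶠ t in 𝓝[>] (0 : ℝ), 0 < t ∧ C.InCone (t • v) ∧ ‖t • v‖ < η ∧ c.toFun t = C.exp (t • v) := by
  have hsmall : ∀ᶠ t in 𝓝[>] (0 : ℝ), ‖t • v‖ < η := by
    have hc : Continuous fun t : ℝ => ‖t • v‖ := by fun_prop
    have := (hc.tendsto 0).eventually (gt_mem_nhds (show ‖(0 : ℝ) • v‖ < η by simpa using hη))
    exact this.filter_mono nhdsWithin_le_nhds
  filter_upwards [h, self_mem_nhdsWithin, hsmall] with t h1 h2 h3
  exact ⟨h2, Chart.inCone_of_mem_unitCube h1.1, h3, h1.2⟩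

namespace IsDevelopment

variable {H : Type*} [NormedAddCommGroup H] [InnerProductSpace ℝ H] {b : X → H}
  {L : ∀ C : K.Chart p, C.Vec →ₗᵢ[ℝ] H} {C C' : K.Chart p}

/-- A nearby point of `c` lies in a cube with a preimage of `p` close to it. The segment between
them in this cube is a geodesic, so `c` follows it. -/
theorem exists_startsAs (hL : K.IsDevelopment p ε b L) (hX : IsCAT0 X) (hε : K.IsClearance p ε)
    (c : GeodesicFrom p) :
    ∃ (C : K.Chart p) (v : C.Vec), ‖v‖ = 1 ∧ K.StartsAs c C.cell C.pt v := by
  have hpos := hε.pos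
  set t₀ := min c.length (ε / 16) with ht₀
  have ht0 : 0 < t₀ := lt_min c.length_pos (by linarith)
  have htl : t₀ ≤ c.length := min_le_left _ _
  have htε : t₀ ≤ ε / 16 := min_le_right _ _
  have hd : dist p (c.toFun t₀) = t₀ := by rw [dist_comm, c.dist_eq ht0 htl]
  obtain ⟨a, x, hx, hxq⟩ := K.cover (c.toFun t₀)
  obtain ⟨z, hz, hzp, hxz⟩ := hε.exists_preimage (ρ := ε / 8) (by linarith) hx
    (by rw [hxq, hd]; linarith)
  let C : K.Chart p := ⟨a, z, hz, hzp⟩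
  set w : C.Vec := x - z with hw
  have hwx : C.pt + w = x := add_sub_cancel _ _
  have hwm : C.pt + w ∈ unitCube _ := by rw [hwx]; exact hx
  have hwe : C.exp w = c.toFun t₀ := by rw [Chart.exp, hwx]; exact hxq
  have hwc := Chart.inCone_of_mem_unitCube hwm
  have h0m : C.pt + (0 : C.Vec) ∈ unitCube _ := by simpa using C.mem
  have hle : ‖(0 : C.Vec) - w‖ ≤ dist (C.exp 0) (C.exp w) :=
    hL.norm_sub_le_dist hε Chart.inCone_zero hwc (by rw [norm_zero]; linarith) hxz
  have hwn : ‖(0 : C.Vec) - w‖ = t₀ := by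
    refine le_antisymm ?_ ?_
    · rwa [Chart.exp_zero, hwe, hd] at hle
    · have := Chart.dist_exp_le h0m hwm
      rwa [Chart.exp_zero, hwe, hd] at this
  have hgeo := Chart.isGeodesicFromTo_segment h0m hwm hle
  rw [Chart.exp_zero, hwe] at hgeo
  have hc : IsGeodesicFromTo c.toFun p (c.toFun t₀) := by
    refine ⟨c.map_zero, by rw [hd], ?_⟩
    rw [hd]
    exact fun s hs t ht => c.isGeodesicOn s ⟨hs.1, hs.2.trans htl⟩ t ⟨ht.1, ht.2.trans htl⟩
  have hform : ∀ t : ℝ, (0 : C.Vec) + (t / t₀) • (w - 0) = t • (t₀⁻¹ • w) := fun t => by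
    rw [zero_add, sub_zero, smul_smul, div_eq_mul_inv]
  refine ⟨C, t₀⁻¹ • w, ?_, ?_⟩
  · rw [norm_smul, norm_inv, Real.norm_of_nonneg ht0.le]
    rw [zero_sub, norm_neg] at hwn
    rw [hwn, inv_mul_cancel₀ ht0.ne']
  · filter_upwards [Ioc_mem_nhdsGT ht0] with t ht
    have hm := Chart.segment_mem_unitCube h0m hwm (div_nonneg ht.1.le ht0.le)
      ((div_le_one ht0).2 ht.2)
    rw [hform] at hm
    refine ⟨hm, ?_⟩
    have := hX.geodesic_unique hc hgeo (t := t) (by rw [hd]; exact ⟨ht.1.le, ht.2⟩)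
    rw [this, hwn, hform]
    rfl

theorem map_eq_of_startsAs (hL : K.IsDevelopment p ε b L) (hε : K.IsClearance p ε)
    {c : GeodesicFrom p} {v : C.Vec} {v' : C'.Vec} (h : K.StartsAs c C.cell C.pt v)
    (h' : K.StartsAs c C'.cell C'.pt v') : L C v = L C' v' := by
  obtain ⟨t, ⟨ht, h1, h2, h3⟩, -, h1', h2', h3'⟩ :=
    ((h.eventually (half_pos hε.pos)).and (h'.eventually (half_pos hε.pos))).exists
  have := hL.compat C C' _ _ h1 h1' h2 h2' (h3.symm.trans h3')
  rw [map_smul, map_smul] at this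
  exact smul_right_injective H ht.ne' this

/-- The development does not increase distances, and the velocities keep their lengths; so all small
comparison angles are at least the angle between the images. -/
theorem cos_alexandrovAngle_le (hL : K.IsDevelopment p ε b L) (hε : K.IsClearance p ε)
    {c c' : GeodesicFrom p} {v : C.Vec} {v' : C'.Vec} (hv : ‖v‖ = 1) (hv' : ‖v'‖ = 1)
    (h : K.StartsAs c C.cell C.pt v) (h' : K.StartsAs c' C'.cell C'.pt v') :
    Real.cos (alexandrovAngle c c') ≤ inner ℝ (L C v) (L C' v') := by
  have hpos : 0 < ε / 8 := by linarith [hε.pos]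
  have habs := abs_le.1 (abs_real_inner_le_norm (L C v) (L C' v'))
  rw [(L C).norm_map, (L C').norm_map, hv, hv', one_mul] at habs
  have key : Real.arccos (inner ℝ (L C v) (L C' v')) ≤ alexandrovAngle c c' := by
    refine le_limsup_of_frequently_le (Eventually.frequently ?_)
      (comparisonAngle_isBoundedUnder_le c c')
    filter_upwards [(h.eventually hpos).prod_mk (h'.eventually hpos)] with z hz
    obtain ⟨⟨hs, h1, h2, h3⟩, ht, h1', h2', h3'⟩ := hz
    have hd := hL.norm_map_sub_le hε h1 h1' h2 h2'
    rw [← h3, ← h3'] at hd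
    refine Real.arccos_le_arccos ?_
    rw [div_le_iff₀ (by positivity)]
    have hsq := pow_le_pow_left₀ (norm_nonneg _) hd 2
    rw [norm_sub_sq_real, (L C).norm_map, (L C').norm_map, map_smul, map_smul, norm_smul,
      norm_smul, hv, hv', inner_smul_left, inner_smul_right, Real.norm_of_nonneg hs.le,
      Real.norm_of_nonneg ht.le, conj_trivial] at hsq
    linarith
  rw [← Real.cos_arccos habs.1 habs.2]
  exact Real.cos_le_cos_of_nonneg_of_le_pi (Real.arccos_nonneg _) (alexandrovAngle_le_pi _ _) key

/-- Inserting `dist_sq_le` into the law of cosines bounds every small comparison angle by the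
arccosine of `x`, whatever the ratio of the two parameters. -/
theorem le_cos_alexandrovAngle (hL : K.IsDevelopment p ε b L) (hX : IsCAT0 X)
    (hε : K.IsClearance p ε)
    {c c' : GeodesicFrom p} {v : C.Vec} {v' : C'.Vec} (hv : ‖v‖ = 1) (hv' : ‖v'‖ = 1)
    (h : K.StartsAs c C.cell C.pt v) (h' : K.StartsAs c' C'.cell C'.pt v') :
    2 * inner ℝ (L C v) (L C' v') - 1 ≤ Real.cos (alexandrovAngle c c') := by
  set x := 2 * inner ℝ (L C v) (L C' v') - 1 with hx
  have hpow : (0 : ℝ) < 2 ^ K.dim C.cell := by positivity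
  have hpos : 0 < ε / 8 / 2 ^ K.dim C.cell / 2 := by have := hε.pos; positivity
  have hle1 : x ≤ 1 := by
    have := real_inner_le_norm (L C v) (L C' v')
    rw [(L C).norm_map, (L C').norm_map, hv, hv'] at this
    linarith
  have key : alexandrovAngle c c' ≤ Real.arccos x := by
    refine limsup_le_of_le (comparisonAngle_isBoundedUnder_ge c c').isCoboundedUnder_le ?_
    filter_upwards [(h.eventually hpos).prod_mk (h'.eventually hpos)] with z hz
    obtain ⟨⟨hs, h1, h2, h3⟩, ht, h1', h2', h3'⟩ := hz
    have hsmall : 2 ^ K.dim C.cell * (‖z.1 • v‖ + ‖z.2 • v'‖) < ε / 8 := by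
      have : ‖z.1 • v‖ + ‖z.2 • v'‖ < ε / 8 / 2 ^ K.dim C.cell := by linarith
      rwa [lt_div_iff₀' hpow] at this
    have hd := hL.dist_sq_le hX hε h1 h1' hsmall
    rw [← h3, ← h3', map_smul, map_smul, norm_smul, norm_smul, hv, hv', inner_smul_left,
      inner_smul_right, Real.norm_of_nonneg hs.le, Real.norm_of_nonneg ht.le,
      conj_trivial] at hd
    refine Real.arccos_le_arccos ?_
    rw [le_div_iff₀ (by positivity), hx]
    linarith
  have hcos := Real.cos_le_cos_of_nonneg_of_le_pi (alexandrovAngle_nonneg c c')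
    (Real.arccos_le_pi x) key
  -- Below `-1` the arccosine is cut off at `π`, but the claim is then trivial.
  rcases le_total (-1) x with hx1 | hx1
  · rwa [Real.cos_arccos hx1 hle1] at hcos
  · exact hx1.trans (Real.neg_one_le_cos _)

end IsDevelopment

end CubeComplex

/-! ### From cosine bounds to bounds on the cone metric. -/

theorem sq_thirdSide (r s a : ℝ) :
    thirdSide r s a ^ 2 = r ^ 2 + s ^ 2 - 2 * r * s * Real.cos a := by
  refine Real.sq_sqrt ?_
  nlinarith [Real.sin_sq_add_cos_sq a, sq_nonneg (r - s * Real.cos a),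
    sq_nonneg (s * Real.sin a)]

namespace TangentVector

variable {X : Type u} [MetricSpace X] {p : X} {H : Type*} [NormedAddCommGroup H]
  [InnerProductSpace ℝ H]

/-- The radial extension of a map defined on directions. -/
def radialMap (g : GeodesicFrom p → H) : TangentVector p → H
  | origin => 0
  | ray r c => (r : ℝ) • g c

variable {g : GeodesicFrom p → H}

theorem norm_radialMap (hg : ∀ c, ‖g c‖ = 1) (w : TangentVector p) :
    ‖radialMap g w‖ = dist origin w := by
  cases w with
  | origin => rw [dist_self, radialMap, norm_zero]
  | ray r c =>
    rw [radialMap, norm_smul, hg, mul_one, Real.norm_of_nonneg r.coe_nonneg]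
    rfl

theorem norm_smul_sub_smul_sq (hg : ∀ c, ‖g c‖ = 1) (r s : ℝ) (c c' : GeodesicFrom p) :
    ‖r • g c - s • g c'‖ ^ 2 = r ^ 2 + s ^ 2 - 2 * r * s * inner ℝ (g c) (g c') := by
  rw [norm_sub_sq_real, norm_smul, norm_smul, hg, hg, inner_smul_left, inner_smul_right,
    mul_one, mul_one, Real.norm_eq_abs, Real.norm_eq_abs, sq_abs, sq_abs, conj_trivial]
  ring

theorem norm_radialMap_sub_le (hg : ∀ c, ‖g c‖ = 1)
    (h : ∀ c c', Real.cos (alexandrovAngle c c') ≤ inner ℝ (g c) (g c')) (u w : TangentVector p) :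
    ‖radialMap g u - radialMap g w‖ ≤ dist u w := by
  rcases u with _ | ⟨r, c⟩
  · rw [radialMap, zero_sub, norm_neg, norm_radialMap hg]
  rcases w with _ | ⟨s, c'⟩
  · rw [dist_comm, ← norm_radialMap hg, radialMap, sub_zero]
  refine abs_le_of_sq_le_sq' ?_ dist_nonneg |>.2
  change ‖(r : ℝ) • g c - (s : ℝ) • g c'‖ ^ 2 ≤ thirdSide r s (alexandrovAngle c c') ^ 2
  rw [norm_smul_sub_smul_sq hg, sq_thirdSide]
  have := mul_le_mul_of_nonneg_left (h c c') (by positivity : 0 ≤ 2 * (r : ℝ) * s)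
  linarith

theorem dist_le_norm_radialMap_sub (hg : ∀ c, ‖g c‖ = 1)
    (h : ∀ c c', 2 * inner ℝ (g c) (g c') - 1 ≤ Real.cos (alexandrovAngle c c'))
    (u w : TangentVector p) : dist u w ≤ Real.sqrt 2 * ‖radialMap g u - radialMap g w‖ := by
  have h2 : 1 ≤ Real.sqrt 2 := Real.one_le_sqrt.2 one_le_two
  rcases u with _ | ⟨r, c⟩
  · rw [radialMap, zero_sub, norm_neg, norm_radialMap hg]
    exact le_mul_of_one_le_left dist_nonneg h2
  rcases w with _ | ⟨s, c'⟩
  · rw [dist_comm, ← norm_radialMap hg, radialMap, sub_zero]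
    exact le_mul_of_one_le_left (norm_nonneg _) h2
  refine abs_le_of_sq_le_sq' ?_ (by positivity) |>.2
  change thirdSide r s (alexandrovAngle c c') ^ 2 ≤
    (Real.sqrt 2 * ‖(r : ℝ) • g c - (s : ℝ) • g c'‖) ^ 2
  rw [mul_pow, norm_smul_sub_smul_sq hg, sq_thirdSide, Real.sq_sqrt zero_le_two]
  have := mul_le_mul_of_nonneg_left (h c c') (by positivity : 0 ≤ 2 * (r : ℝ) * s)
  -- The cosine bound leaves an excess of `2 * r * s`, absorbed by `r ^ 2 + s ^ 2`; here the
  -- constant `√2` arises.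
  nlinarith [sq_nonneg ((r : ℝ) - s)]

end TangentVector

/-! ### Bounds for the distortion -/

section Distortion

variable {T H : Type u} [PseudoMetricSpace T] [NormedAddCommGroup H] {f : T → H} {D : ℝ}

theorem distortion_le [InnerProductSpace ℝ H] [CompleteSpace H] (hD : 0 < D) (hf : HasDistortion f D) :
    distortion T ≤ ENNReal.ofReal D :=
  sInf_le ⟨D, hD, rfl, H, inferInstance, inferInstance, inferInstance, f, hf⟩

theorem radialDistortion_le [InnerProductSpace ℝ H] [CompleteSpace H] (hD : 0 < D) (hf : HasDistortion f D) {O : T}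
    (hO : ∀ v, ‖f v‖ = dist O v) : radialDistortion T O ≤ ENNReal.ofReal D :=
  sInf_le ⟨D, hD, rfl, H, inferInstance, inferInstance, inferInstance, f, hO, hf⟩

theorem HasDistortion.lipschitzWith (hf : HasDistortion f D) : LipschitzWith 1 f :=
  LipschitzWith.of_dist_le_mul fun v w => by
    rw [dist_eq_norm, NNReal.coe_one, one_mul]; exact (hf v w).2

/-- Both inequalities are closed conditions and hold on a dense subset. -/
theorem HasDistortion.completion [CompleteSpace H] (hf : HasDistortion f D) :
    HasDistortion (UniformSpace.Completion.extension f) D := by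
  have hu := hf.lipschitzWith.uniformContinuous
  have hc := UniformSpace.Completion.continuous_extension (f := f)
  intro v w
  induction v, w using UniformSpace.Completion.induction_on₂ with
  | hp =>
    have h1 : IsClosed {x : UniformSpace.Completion T × UniformSpace.Completion T |
        dist x.1 x.2 / D ≤ ‖UniformSpace.Completion.extension f x.1 -
          UniformSpace.Completion.extension f x.2‖} := isClosed_le (by fun_prop) (by fun_prop)
    exact h1.and (isClosed_le (by fun_prop) (by fun_prop))
  | ih v w =>
    rw [UniformSpace.Completion.extension_coe hu, UniformSpace.Completion.extension_coe hu,
      UniformSpace.Completion.dist_eq]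
    exact hf v w

theorem HasDistortion.norm_completion [CompleteSpace H] (hf : HasDistortion f D)
    {O : T} (hO : ∀ v, ‖f v‖ = dist O v) (v : UniformSpace.Completion T) :
    ‖UniformSpace.Completion.extension f v‖ = dist (O : UniformSpace.Completion T) v := by
  have hu := hf.lipschitzWith.uniformContinuous
  have hc := UniformSpace.Completion.continuous_extension (f := f)
  induction v using UniformSpace.Completion.induction_on with
  | hp => exact isClosed_eq (by fun_prop) (by fun_prop)
  | ih v => rw [UniformSpace.Completion.extension_coe hu, UniformSpace.Completion.dist_eq, hO]

end Distortion

/-! ### Assembly of the map on the tangent cone. -/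

theorem mainTheorem4 {Y : Type u} [MetricSpace Y] (hY : IsCAT0 Y) (K : CubeComplex.{u, v} Y)
    (p : Y) :
    distortion (TangentCone p) ≤ ENNReal.ofReal (Real.sqrt 2) ∧
    radialDistortion (TangentCone p) (TangentCone.origin p) ≤ ENNReal.ofReal (Real.sqrt 2) ∧
    distortion (UniformSpace.Completion (TangentCone p)) ≤ ENNReal.ofReal (Real.sqrt 2) ∧
    radialDistortion (UniformSpace.Completion (TangentCone p)) ↑(TangentCone.origin p)
      ≤ ENNReal.ofReal (Real.sqrt 2) ∧
    ∃ (H : Type u) (_ : NormedAddCommGroup H) (_ : InnerProductSpace ℝ H) (_ : CompleteSpace H)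
      (f : TangentCone p → H),
      (∀ w, ‖f w‖ = dist (TangentCone.origin p) w) ∧
      HasDistortion f (Real.sqrt 2) ∧
      (∀ u w, K.IsEdgeDirection p u → K.IsEdgeDirection p w → u ≠ w →
        inner ℝ (f u) (f w) = 0) ∧
      (∀ (a : K.Cell), ∀ x ∈ unitCube (K.dim a), K.char a x = p →
        ∃ L : EuclideanSpace ℝ (Fin (K.dim a)) →ₗᵢ[ℝ] H,
          ∀ (r : ℝ≥0) (c : GeodesicFrom p) (v : EuclideanSpace ℝ (Fin (K.dim a))),
            K.StartsAs c a x v → f (TangentCone.ray r c) = (r : ℝ) • L v) := by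
  obtain ⟨ε, hε⟩ := K.exists_isClearance p
  obtain ⟨H, _, _, _, b, L, hL⟩ := K.exists_isDevelopment hY hε
  choose C v hv hstart using hL.exists_startsAs hY hε
  let g : GeodesicFrom p → H := fun c => L (C c) (v c)
  have hg : ∀ c, ‖g c‖ = 1 := fun c => by rw [(L (C c)).norm_map, hv]
  have hlower := TangentVector.norm_radialMap_sub_le hg fun c c' =>
    hL.cos_alexandrovAngle_le hε (hv c) (hv c') (hstart c) (hstart c')
  have hupper := TangentVector.dist_le_norm_radialMap_sub hg fun c c' =>
    hL.le_cos_alexandrovAngle hY hε (hv c) (hv c') (hstart c) (hstart c')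
  -- The Lipschitz bound makes the radial map constant on classes of vectors at distance zero.
  let f : TangentCone p → H := SeparationQuotient.lift (TangentVector.radialMap g) fun x y h => by
    have := hlower x y
    rw [Metric.inseparable_iff.1 h] at this
    exact sub_eq_zero.1 (norm_le_zero_iff.1 this)
  have hnorm : ∀ w, ‖f w‖ = dist (TangentCone.origin p) w := fun w => by
    obtain ⟨w, rfl⟩ := SeparationQuotient.surjective_mk w
    exact TangentVector.norm_radialMap hg w
  have h2 : 0 < Real.sqrt 2 := Real.sqrt_pos.2 two_pos
  have hf : HasDistortion f (Real.sqrt 2) := fun u w => by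
    obtain ⟨u, rfl⟩ := SeparationQuotient.surjective_mk u
    obtain ⟨w, rfl⟩ := SeparationQuotient.surjective_mk w
    exact ⟨(div_le_iff₀' h2).2 (hupper u w), hlower u w⟩
  have hray : ∀ (D : K.Chart p) (r : ℝ≥0) (c : GeodesicFrom p) (w : D.Vec),
      K.StartsAs c D.cell D.pt w → f (TangentCone.ray r c) = (r : ℝ) • L D w := fun D r c w hw =>
    congrArg (fun y => (r : ℝ) • y) (hL.map_eq_of_startsAs hε (hstart c) hw)
  refine ⟨distortion_le h2 hf, radialDistortion_le h2 hf hnorm, distortion_le h2 hf.completion,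
    radialDistortion_le h2 hf.completion (hf.norm_completion hnorm),
    H, inferInstance, inferInstance, inferInstance, f, hnorm, hf, ?_, ?_⟩
  · have hedge : ∀ u, K.IsEdgeDirection p u → ∃ y, f u = b y := by
      rintro u ⟨a, x, i, c, hx, hxp, hc, rfl⟩
      have hxm : x ∈ unitCube (K.dim a) := fun j => by rcases hx j with h | h <;> simp [h]
      let D : K.Chart p := ⟨a, x, hxm, hxp⟩
      refine ⟨D.label ε i, ?_⟩
      rw [hray D 1 c _ hc, NNReal.coe_one, one_smul]
      exact hL.map_edge D i (hx i)
    intro u w hu hw huw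
    obtain ⟨y, hy⟩ := hedge u hu
    obtain ⟨y', hy'⟩ := hedge w hw
    rw [hy, hy']
    -- With equal labels the two images coincide, and the lower distortion bound then forces `u =
    -- w`.
    refine hL.orthonormal.2 fun hyy => huw ?_
    have := (hf u w).1
    rw [hy, hy', hyy, sub_self, norm_zero, div_le_iff₀ h2, zero_mul] at this
    exact dist_le_zero.1 this
  · intro a x hx hxp
    exact ⟨L ⟨a, x, hx, hxp⟩, fun r c w hw => hray ⟨a, x, hx, hxp⟩ r c w hw⟩
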